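/- \textbf{Setting.} Let $T$ be a complete first-order theory in a many-sorted language $\mathcal L$ with set of sorts $\mathcal J$. Assume that $T$ has uniform elimination of imaginaries: for every finite tuple of sorts $J=(S_1,\dots,S_n)$, every $\emptyset$-definable equivalence relation on $S_J=S_1\times\cdots\times S_n$ is of the form $f(x)=f(y)$ for some $\emptyset$-definable function $f:S_J\to S_{J'}$. Let $\mathfrak C\models T$ be a monster model, i.e. a $\bar\kappa$-saturated and strongly $\bar\kappa$-homogeneous model for some $\bar\kappa>|T|$; ``small'' means of cardinality $<\bar\kappa$. Let $M\preceq\mathfrak C$, and let $K\subseteq M$ be small with $K=\mathrm{dcl}(K)$. Write $(M,K)$ for the expansion of $M$ by a predicate for $K$ (one unary predicate on each sort). For $Y\subseteq X\subseteq\mathfrak C$, let $\mathrm{Aut}(X/Y)$ be the group of sort-preserving permutations of $X$ that are elementary in $\mathfrak C$ and fix $Y$ pointwise. Let $G(K)=\mathrm{Aut}(\mathrm{acl}(K)/\mathrm{dcl}(K))$ with the topology of pointwise convergence. For an open normal subgroup $H$ of $G(K)$ put $L_H=\mathrm{acl}(K)^H$, and let $\mathcal F(H)$ be the set of finite tuples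 of sorts $J$ such that $|\mathrm{Aut}_J(L_H/K)|=|\mathrm{Aut}(L_H/K)|$, where $\mathrm{Aut}_J(L_H/K)$ is the image of $\mathrm{Aut}(L_H/K)$ in the group of permutations of $S_J(L_H)$. The sorted complete system $SG(K)$ is the following many-sorted structure. Its sorts are $m(k,J)$, for $k<\omega$ and $J$ a finite tuple of sorts, and $$m(k,J)=\{gH : g\in G(K),\ H\trianglelefteq G(K)\text{ open},\ [G(K):H]\le k,\ J\in\mathcal F(H)\}.$$ It has binary relations $\le$ and $C$ between any two sorts and a ternary relation $P$ on every sort, given by - $gH\le g'H'$ iff $H\subseteq H'$; - $C(gH,g'H')$ iff $H\subseteq H'$ and $gH'=g'H'$; - $P(g_1H_1,g_2H_2,g_3H_3)$ iff $H_1=H_2=H_3$ and $g_1g_2H_1=g_3H_1$. \textbf{Theorem.} The structure $SG(K)$ is interpretable without parameters in $(M,K)$: each sort of $SG(K)$ is in bijection with the quotient of a $\emptyset$-definable subset of a finite product of sorts of $(M,K)$ by a $\emptyset$-definable equivalence relation, in such a way that every basic relation of $SG(K)$ corresponds to a $\emptyset$-definable relation in $(M,K)$. Consequently, for every infinite cardinal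 $\kappa$, if $(M,K)$ is $\kappa$-saturated, then $SG(K)$ is $\kappa$-saturated. -/

import Mathlib

open Cardinal

universe u v

/-- A many-sorted first-order language with set of sorts `ι`.  Function and relation symbols
have finite lists of sorts as arities. -/
structure SortedLanguage (ι : Type u) where
  Fn : List ι → ι → Type u
  Rel : List ι → Type u

namespace SortedLanguage

variable {ι : Type u}

/-! ### Terms, formulas, structures -/

/-- Terms of a given sort, with free variables indexed by `α`; the variable `a` has
sort `s a`. -/
inductive Term (L : SortedLanguage ι) {α : Type v} (s : α → ι) : ι → Type (max u v)
  | var (a : α) : Term L s (s a)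
  | app {J : List ι} {j : ι} (f : L.Fn J j)
      (t : ∀ i : Fin J.length, Term L s (J.get i)) : Term L s j

/-- The sorts of the variables `α` together with one new variable (`none`) of sort `j`. -/
def extend {α : Type v} (s : α → ι) (j : ι) : Option α → ι
  | none => j
  | some a => s a

/-- First-order formulas with free variables indexed by `α`; the variable `a` has sort `s a`.
The quantifier `all j` binds a variable of sort `j`. -/
inductive Formula (L : SortedLanguage ι) : {α : Type v} → (α → ι) → Type (max u (v + 1))
  | falsum {α : Type v} {s : α → ι} : Formula L s
  | eq {α : Type v} {s : α → ι} {j : ι} (t₁ t₂ : Term L s j) : Formula L s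
  | rel {α : Type v} {s : α → ι} {J : List ι} (R : L.Rel J)
      (t : ∀ i : Fin J.length, Term L s (J.get i)) : Formula L s
  | imp {α : Type v} {s : α → ι} (φ ψ : Formula L s) : Formula L s
  | all {α : Type v} {s : α → ι} (j : ι) (φ : Formula L (extend s j)) : Formula L s

/-- A many-sorted structure.  Sorts may be empty. -/
structure Str (L : SortedLanguage ι) where
  carrier : ι → Type u
  fn : ∀ {J : List ι} {j : ι}, L.Fn J j → (∀ i : Fin J.length, carrier (J.get i)) → carrier j
  rel : ∀ {J : List ι}, L.Rel J → (∀ i : Fin J.length, carrier (J.get i)) → Prop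

namespace Str

variable {L : SortedLanguage ι} (C : L.Str)

/-- `S_J(C)`, the product of the sorts listed in `J`. -/
abbrev Tup (J : List ι) : Type u := ∀ i : Fin J.length, C.carrier (J.get i)

/-- The value of a term under an assignment. -/
def val {α : Type v} {s : α → ι} (x : ∀ a, C.carrier (s a)) :
    {j : ι} → L.Term s j → C.carrier j
  | _, .var a => x a
  | _, .app f t => C.fn f (fun i => val x (t i))

/-- Extension of an assignment by a value for the new variable. -/
def extendVal {α : Type v} {s : α → ι} (x : ∀ a, C.carrier (s a)) {j : ι} (y : C.carrier j) :
    ∀ o : Option α, C.carrier (extend s j o)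
  | none => y
  | some a => x a

/-- Tarskian truth of a formula under an assignment of its free variables. -/
def Sat : {α : Type v} → {s : α → ι} → L.Formula s → (∀ a, C.carrier (s a)) → Prop
  | _, _, .falsum, _ => False
  | _, _, .eq t₁ t₂, x => C.val x t₁ = C.val x t₂
  | _, _, .rel R t, x => C.rel R (fun i => C.val x (t i))
  | _, _, .imp φ ψ, x => Sat φ x → Sat ψ x
  | _, _, .all j φ, x => ∀ y : C.carrier j, Sat φ (C.extendVal x y)

/-- Definability without parameters. -/
def Definable {α : Type v} (s : α → ι) (D : Set (∀ a, C.carrier (s a))) : Prop :=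
  ∃ φ : L.Formula s, ∀ x, x ∈ D ↔ C.Sat φ x

/-- Subsets of `C`, given sort by sort. -/
abbrev SSet : Type u := ∀ j : ι, Set (C.carrier j)

variable {C}

/-- The elements of a subset `A` of `C`, all sorts together. -/
abbrev SSet.Elem (A : C.SSet) : Type u := Σ j : ι, A j

/-- The sorts of the variables `β` together with names for the elements of `A`. -/
def withParams {β : Type v} (s : β → ι) (A : C.SSet) : β ⊕ A.Elem → ι
  | .inl b => s b
  | .inr p => p.1

/-- The assignment that gives the variables `β` the values `x` and interprets the name of
every element of `A` by that element. -/
def withParamsVal {β : Type v} {s : β → ι} (A : C.SSet) (x : ∀ b, C.carrier (s b)) :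
    ∀ c : β ⊕ A.Elem, C.carrier (withParams s A c)
  | .inl b => x b
  | .inr p => p.2.1

variable (C)

/-- The set of solutions in sort `j` of a formula in one variable with parameters in `A`. -/
def solutions (A : C.SSet) (j : ι)
    (φ : L.Formula (withParams (fun _ : Unit => j) A)) : Set (C.carrier j) :=
  {y | C.Sat φ (withParamsVal A (fun _ : Unit => y))}

/-- Algebraic closure. -/
def acl (A : C.SSet) : C.SSet := fun j =>
  {x | ∃ φ : L.Formula (withParams (fun _ : Unit => j) A),
    x ∈ C.solutions A j φ ∧ (C.solutions A j φ).Finite}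

/-- Definable closure. -/
def dcl (A : C.SSet) : C.SSet := fun j =>
  {x | ∃ φ : L.Formula (withParams (fun _ : Unit => j) A), C.solutions A j φ = {x}}

/-! ### Saturation, homogeneity, elementary substructures, elimination of imaginaries -/

/-- `κ`-saturation: every set of formulas in finitely many variables, with parameters in a
set of fewer than `κ` elements, that is finitely satisfiable in `C` is realized in `C`. -/
def Saturated (κ : Cardinal.{u}) : Prop :=
  ∀ A : C.SSet, #A.Elem < κ →
    ∀ (β : Type) [Finite β] (s : β → ι) (p : Set (L.Formula (withParams s A))),
      (∀ q ⊆ p, q.Finite →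
        ∃ x : ∀ b, C.carrier (s b), ∀ φ ∈ q, C.Sat φ (withParamsVal A x)) →
      ∃ x : ∀ b, C.carrier (s b), ∀ φ ∈ p, C.Sat φ (withParamsVal A x)

/-- A sort-preserving map from a subset `A` of `C` to `C` is elementary if it preserves the
truth of all formulas. -/
def IsElementaryMap (A : C.SSet) (f : ∀ j, A j → C.carrier j) : Prop :=
  ∀ (α : Type u) (s : α → ι) (φ : L.Formula s) (x : ∀ a, A (s a)),
    C.Sat φ (fun a => (x a).1) ↔ C.Sat φ (fun a => f (s a) (x a))

/-- Automorphisms of the structure `C`. -/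
def IsAutomorphism (g : ∀ j, Equiv.Perm (C.carrier j)) : Prop :=
  (∀ {J : List ι} {j : ι} (f : L.Fn J j) (x : C.Tup J),
    g j (C.fn f x) = C.fn f (fun i => g _ (x i))) ∧
  (∀ {J : List ι} (R : L.Rel J) (x : C.Tup J), C.rel R (fun i => g _ (x i)) ↔ C.rel R x)

/-- Strong `κ`-homogeneity: elementary maps defined on sets of fewer than `κ` elements extend
to automorphisms. -/
def StronglyHomogeneous (κ : Cardinal.{u}) : Prop :=
  ∀ (A : C.SSet) (f : ∀ j, A j → C.carrier j), #A.Elem < κ → C.IsElementaryMap A f →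
    ∃ g : ∀ j, Equiv.Perm (C.carrier j), C.IsAutomorphism g ∧ ∀ j (x : A j), g j x.1 = f j x

/-- `C` is a monster model with respect to the cardinal `κ`: it is `κ`-saturated and strongly
`κ`-homogeneous, where `κ` exceeds `ℵ₀` and the numbers of sorts and of symbols of the
language.  A subset of `C` is small if it has fewer than `κ` elements. -/
structure IsMonster (κ : Cardinal.{u}) : Prop where
  aleph0_lt : ℵ₀ < κ
  sorts_lt : #ι < κ
  fn_lt : #(Σ (J : List ι) (j : ι), L.Fn J j) < κ
  rel_lt : #(Σ J : List ι, L.Rel J) < κ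
  saturated : C.Saturated κ
  homogeneous : C.StronglyHomogeneous κ

/-- Uniform elimination of imaginaries for the complete theory `Th(C)`: every equivalence
relation on a product of sorts that is definable without parameters is the fibration of a
function, definable without parameters, to a product of sorts. -/
def UniformEI : Prop :=
  ∀ (J : List ι) (E : Setoid (C.Tup J)),
    C.Definable (Sum.elim J.get J.get)
      {x | E (fun i => x (Sum.inl i)) (fun i => x (Sum.inr i))} →
    ∃ (J' : List ι) (f : C.Tup J → C.Tup J'),
      C.Definable (Sum.elim J.get J'.get)
        {x | f (fun i => x (Sum.inl i)) = fun i => x (Sum.inr i)} ∧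
      ∀ a b, E a b ↔ f a = f b

/-- Substructures of `C`. -/
structure Substr where
  set : C.SSet
  fn_mem : ∀ {J : List ι} {j : ι} (f : L.Fn J j) (x : C.Tup J),
    (∀ i, x i ∈ set (J.get i)) → C.fn f x ∈ set j

variable {C}

/-- A substructure as a structure. -/
def Substr.toStr (M : C.Substr) : L.Str where
  carrier j := M.set j
  fn f x := ⟨C.fn f (fun i => (x i).1), M.fn_mem f _ (fun i => (x i).2)⟩
  rel R x := C.rel R (fun i => (x i).1)

/-- `M` is an elementary substructure of `C`. -/
def Substr.IsElementary (M : C.Substr) : Prop :=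
  ∀ (α : Type u) (s : α → ι) (φ : L.Formula s) (x : ∀ a, M.set (s a)),
    M.toStr.Sat φ x ↔ C.Sat φ (fun a => (x a).1)

end Str

/-! ### Pairs -/

/-- The relation symbols of `L` together with a unary predicate on every sort. -/
inductive PairRel (L : SortedLanguage ι) : List ι → Type u
  | base {J : List ι} (R : L.Rel J) : PairRel L J
  | pred (j : ι) : PairRel L [j]

/-- The language `L` together with a predicate `P` (one unary predicate on every sort). -/
def withPred (L : SortedLanguage ι) : SortedLanguage ι where
  Fn := L.Fn
  Rel := PairRel L

/-- The interpretation of the relation symbols in the pair `(M, K)`. -/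
def Str.Substr.pairRel {L : SortedLanguage ι} {C : L.Str} (M : C.Substr) (K : C.SSet) :
    {J : List ι} → PairRel L J → (∀ i : Fin J.length, M.set (J.get i)) → Prop
  | _, .base R, x => C.rel R (fun i => (x i).1)
  | _, .pred j, x => (x ⟨0, Nat.zero_lt_one⟩).1 ∈ K j

/-- The pair `(M, K)`: the structure `M` with the predicate interpreted as `K`. -/
def Str.Substr.pair {L : SortedLanguage ι} {C : L.Str} (M : C.Substr) (K : C.SSet) :
    (withPred L).Str where
  carrier j := M.set j
  fn f x := M.toStr.fn (L := L) f x
  rel R x := M.pairRel K R x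

/-! ### Interpretations without parameters -/

/-- `N` is interpretable without parameters in `M`: every sort of `N` is the image of a set
definable without parameters in a finite product of sorts of `M`, in such a way that the
preimages of equality, of all relations and of the graphs of all functions of `N` are definable
without parameters. -/
def Str.InterpretableIn {ι' : Type u} {L' : SortedLanguage ι'} {L : SortedLanguage ι}
    (N : L'.Str) (M : L.Str) : Prop :=
  ∃ (J : ι' → List ι) (D : ∀ j, Set (M.Tup (J j))) (f : ∀ j, D j → N.carrier j),
    (∀ j, M.Definable (J j).get (D j)) ∧
    (∀ j, Function.Surjective (f j)) ∧
    (∀ j, M.Definable (Sum.elim (J j).get (J j).get)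
      {x | ∃ (h₁ : (fun i => x (Sum.inl i)) ∈ D j) (h₂ : (fun i => x (Sum.inr i)) ∈ D j),
        f j ⟨_, h₁⟩ = f j ⟨_, h₂⟩}) ∧
    (∀ (J' : List ι') (R : L'.Rel J'),
      M.Definable
        (fun p : Σ i : Fin J'.length, Fin (J (J'.get i)).length => (J (J'.get p.1)).get p.2)
        {x | ∃ h : ∀ i : Fin J'.length, (fun k => x ⟨i, k⟩) ∈ D (J'.get i),
          N.rel R (fun i => f (J'.get i) ⟨_, h i⟩)}) ∧
    (∀ (J' : List ι') (j : ι') (g : L'.Fn J' j),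
      M.Definable
        (Sum.elim
          (fun p : Σ i : Fin J'.length, Fin (J (J'.get i)).length => (J (J'.get p.1)).get p.2)
          (J j).get)
        {x | ∃ (h : ∀ i : Fin J'.length, (fun k => x (Sum.inl ⟨i, k⟩)) ∈ D (J'.get i))
            (h' : (fun k => x (Sum.inr k)) ∈ D j),
          N.fn g (fun i => f (J'.get i) ⟨_, h i⟩) = f j ⟨_, h'⟩})

/-! ### Galois groups -/

namespace Str

variable {L : SortedLanguage ι} (C : L.Str)

/-- `Aut(X/Y)`: the group of all elementary (in the sense of `C`) sort-preserving permutations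
of `X` that fix `Y` pointwise. -/
def autGroup (X Y : C.SSet) : Subgroup (∀ j, Equiv.Perm (X j)) where
  carrier := {σ | C.IsElementaryMap X (fun j x => (σ j x).1) ∧
    ∀ j (x : X j), x.1 ∈ Y j → σ j x = x}
  one_mem' := ⟨fun _ _ _ _ => Iff.rfl, fun _ _ _ => rfl⟩
  mul_mem' := by
    rintro σ τ ⟨hσ, hσ'⟩ ⟨hτ, hτ'⟩
    refine ⟨fun α s φ x => (hτ α s φ x).trans (hσ α s φ fun a => τ (s a) (x a)), ?_⟩
    intro j x hx
    simp [hτ' j x hx, hσ' j x hx]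
  inv_mem' := by
    rintro σ ⟨hσ, hσ'⟩
    refine ⟨fun α s φ x => ?_, fun j x hx => ?_⟩
    · have h := hσ α s φ fun a => (σ⁻¹) (s a) (x a)
      simpa using h.symm
    · simpa using (Equiv.symm_apply_eq (σ j)).2 (hσ' j x hx).symm

/-- The topology of pointwise convergence on `Aut(X/Y)`, with `X` discrete. -/
abbrev autTopology (X Y : C.SSet) : TopologicalSpace (C.autGroup X Y) :=
  TopologicalSpace.induced (fun σ (p : X.Elem) => σ.1 p.1 p.2)
    (@Pi.topologicalSpace X.Elem (fun p => X p.1) (fun _ => ⊥))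

/-- The absolute Galois group `G(K) = Aut(acl(K)/dcl(K))`. -/
abbrev absGal (K : C.SSet) : Type u := C.autGroup (C.acl K) (C.dcl K)

/-- Open normal subgroups of `G(K)`. -/
def IsOpenNormal (K : C.SSet) (H : Subgroup (C.absGal K)) : Prop :=
  H.Normal ∧ @IsOpen _ (C.autTopology (C.acl K) (C.dcl K)) (H : Set (C.absGal K))

/-- The fixed set `acl(K)^H` of a subgroup `H` of `G(K)`. -/
def fixedSet (K : C.SSet) (H : Subgroup (C.absGal K)) : C.SSet := fun j =>
  {x | ∃ hx : x ∈ C.acl K j, ∀ σ ∈ H, σ.1 j ⟨x, hx⟩ = ⟨x, hx⟩}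

/-- The permutation of `S_J(X)` induced by a sort-preserving permutation of `X`. -/
def tupPerm {C : L.Str} {X : C.SSet} (J : List ι) (σ : ∀ j, Equiv.Perm (X j)) :
    Equiv.Perm (∀ i : Fin J.length, X (J.get i)) :=
  Equiv.piCongrRight fun i => σ (J.get i)

/-- `Aut_J(X/Y)`: the image of `Aut(X/Y)` under restriction to `S_J(X)`. -/
def autImage (X Y : C.SSet) (J : List ι) :
    Set (Equiv.Perm (∀ i : Fin J.length, X (J.get i))) :=
  {τ | ∃ σ ∈ C.autGroup X Y, τ = tupPerm J σ}

/-- The sorting data `F(H) = {J : |Aut_J(acl(K)^H/K)| = |Aut(acl(K)^H/K)|}` on open normal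
subgroups `H` of `G(K)`. -/
def sorting (K : C.SSet) (H : Subgroup (C.absGal K)) : Set (List ι) :=
  {J | #(C.autImage (C.fixedSet K H) K J) = #(C.autGroup (C.fixedSet K H) K)}

end Str

/-! ### The system `SG(K)` -/

/-- The relation symbols on the sorts `m(k, J)`, with `k : ℕ` and `J` a finite list of sorts:
binary symbols `≤` and `C` for every two sorts and a ternary symbol `P` for every sort. -/
inductive SystemRel (ι : Type u) : List (ℕ × List ι) → Type u
  | le (a b : ℕ × List ι) : SystemRel ι [a, b]
  | proj (a b : ℕ × List ι) : SystemRel ι [a, b]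
  | prod (a : ℕ × List ι) : SystemRel ι [a, a, a]

/-- The language of sorted complete systems over the sorts `ι`. -/
def systemLang (ι : Type u) : SortedLanguage (ℕ × List ι) where
  Fn _ _ := PEmpty
  Rel := SystemRel ι

namespace Str

variable {L : SortedLanguage ι} (C : L.Str)

/-- The sort `m(k, J)` of `SG(K)`: the cosets `gH` of open normal subgroups `H` of `G(K)` of
index at most `k` with `J ∈ F(H)`.  A coset is given together with its (unique) subgroup. -/
def SGSort (K : C.SSet) (a : ℕ × List ι) : Type u :=
  Σ H : {H : Subgroup (C.absGal K) //
    C.IsOpenNormal K H ∧ H.index ≠ 0 ∧ H.index ≤ a.1 ∧ a.2 ∈ C.sorting K H},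
  C.absGal K ⧸ H.1

variable {C}

/-- `gH ≤ g'H'` iff `H ⊆ H'`. -/
def SGLe {K : C.SSet} {a b : ℕ × List ι} (x : C.SGSort K a) (y : C.SGSort K b) : Prop :=
  x.1.1 ≤ y.1.1

/-- `C(gH, g'H')` iff `H ⊆ H'` and `gH' = g'H'`. -/
def SGProj {K : C.SSet} {a b : ℕ × List ι} (x : C.SGSort K a) (y : C.SGSort K b) : Prop :=
  x.1.1 ≤ y.1.1 ∧
    ∃ g : C.absGal K, x.2 = (g : C.absGal K ⧸ x.1.1) ∧ y.2 = (g : C.absGal K ⧸ y.1.1)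

/-- `P(g₁H₁, g₂H₂, g₃H₃)` iff `H₁ = H₂ = H₃` and `g₁g₂H₁ = g₃H₁`. -/
def SGProd {K : C.SSet} {a : ℕ × List ι} (x y z : C.SGSort K a) : Prop :=
  x.1 = y.1 ∧ x.1 = z.1 ∧
    ∃ g₁ g₂ : C.absGal K, x.2 = (g₁ : C.absGal K ⧸ x.1.1) ∧
      y.2 = (g₂ : C.absGal K ⧸ y.1.1) ∧ z.2 = ((g₁ * g₂ : C.absGal K) : C.absGal K ⧸ z.1.1)

/-- The interpretation of the relation symbols in `SG(K)`. -/
def SGRel (K : C.SSet) : {A : List (ℕ × List ι)} → SystemRel ι A →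
    (∀ i : Fin A.length, C.SGSort K (A.get i)) → Prop
  | _, .le a b, x => SGLe (a := a) (b := b) (x ⟨0, by simp⟩) (x ⟨1, by simp⟩)
  | _, .proj a b, x => SGProj (a := a) (b := b) (x ⟨0, by simp⟩) (x ⟨1, by simp⟩)
  | _, .prod a, x => SGProd (a := a) (x ⟨0, by simp⟩) (x ⟨1, by simp⟩) (x ⟨2, by simp⟩)

variable (C)

/-- The sorted complete system `SG(K)` of the absolute Galois group of `K`. -/
def SG (K : C.SSet) : (systemLang ι).Str where
  carrier := C.SGSort K
  fn f _ := nomatch f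
  rel R x := SGRel K R x

end Str

end SortedLanguage

/-!
The system `SG(K)` is interpreted in `(M, K)` by coding a coset `gH` by a pair of finite tuples
`(a, ga)` of algebraic elements, where `a` is chosen with stabilizer `H`. All algebraic elements
lie in `M`, because `M` is an elementary substructure (`acl_le_of_isElementary`).

*Conjugacy is definable.* By uniform elimination of imaginaries, the finite sets of at most `N`
tuples of a given sort have codes in one product of sorts, through one definable function. By
saturation and homogeneity of `C`, such a set has its code in `K = dcl(K)` if and only if it is
invariant under the automorphisms over `K` (`IsPair.code_mem_iff`). The conjugates of a tuple with
at most `N` conjugates therefore form the smallest set of at most `N` tuples that contains it and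
has its code in `K`, so conjugacy of such tuples is definable in `(M, K)`
(`IsPair.def_conjOver`). Inclusion of stabilizers, normality, and the relations `≤`, `C`, `P` of
`SG(K)` are first-order expressible through conjugacy of tuples (`IsPair.def_stabLE`,
`IsPair.def_normal`, `CodesCoset.le_iff`, `CodesCoset.proj_iff`, `CodesCoset.prod_iff`).

*The sorts.* Every open subgroup of `G(K)` is the stabilizer of a finite tuple, namely of the code
of a finite orbit (`IsMonster.exists_stab_eq`). Consequently the elements of `Aut(acl(K)^H/K)` are
restrictions of elements of `G(K)`, and `J ∈ F(H)` says that the tuples of sort `J` in `acl(K)^H`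
have common stabilizer `H` (`IsMonster.mem_sorting_iff`). If `[G(K) : H] ≤ k`, then `k` of these
tuples suffice, one for each nontrivial coset. Since `H = G(K)` must be coded even when there is no
tuple of sort `J` fixed by `G(K)`, a point at infinity is added to the tuples of sort `J`, again by
elimination of imaginaries (`IsPair.exists_pointed`, `IsPair.exists_coding`).

No cardinality estimate for `acl(K)` is needed: homogeneity is applied only to maps whose domain
is `K` together with finitely many elements (`IsMonster.exists_extension`).

*Saturation.* Formulas about `SG(K)` translate into formulas about codes
(`exists_translation`), so finitely satisfiable types translate into finitely satisfiable types,
and saturation passes from `(M, K)` to `SG(K)` (`Saturated.of_interpretableIn`).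
-/

universe w

namespace SortedLanguage

variable {ι : Type u} {L : SortedLanguage ι}

/-! ### Formulas and definable sets -/

/-- Renaming of variables in a term; sorts only have to agree propositionally. -/
def Term.relabel {α : Type v} {β : Type w} {s : α → ι} {t : β → ι} (e : α → β)
    (h : ∀ a, t (e a) = s a) : {j : ι} → L.Term s j → L.Term t j
  | _, .var a => h a ▸ .var (e a)
  | _, .app f ts => .app f fun i => (ts i).relabel e h

/-- Renaming is compatible with the sorts after the addition of a bound variable. -/
theorem extend_map {α : Type v} {β : Type w} {s : α → ι} {t : β → ι} (e : α → β)
    (h : ∀ a, t (e a) = s a) (j : ι) :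
    ∀ o, extend t j (Option.map e o) = extend s j o
  | none => rfl
  | some a => h a

/-- Renaming of the free variables of a formula. -/
def Formula.relabel {α : Type v} {s : α → ι} (φ : L.Formula s) :
    ∀ {β : Type w} {t : β → ι} (e : α → β) (_ : ∀ a, t (e a) = s a), L.Formula t :=
  match φ with
  | .falsum => fun _ _ => .falsum
  | .eq t₁ t₂ => fun e h => .eq (t₁.relabel e h) (t₂.relabel e h)
  | .rel R ts => fun e h => .rel R fun i => (ts i).relabel e h
  | .imp φ ψ => fun e h => .imp (φ.relabel e h) (ψ.relabel e h)
  | .all j φ => fun e h => .all j (φ.relabel (Option.map e) (extend_map e h j))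

namespace Str

variable (C : L.Str)

theorem val_relabel {α : Type v} {β : Type w} {s : α → ι} {t : β → ι} (e : α → β)
    (h : ∀ a, t (e a) = s a) (x : ∀ b, C.carrier (t b)) {j : ι} (T : L.Term s j) :
    C.val x (T.relabel e h) = C.val (fun a => h a ▸ x (e a)) T := by
  obtain rfl : (fun a => t (e a)) = s := funext h
  induction T with
  | var a => rfl
  | app f ts ih => simp only [Term.relabel, val]; congr 1; funext i; exact ih i

theorem sat_relabel {α : Type v} {s : α → ι} (φ : L.Formula s) :
    ∀ {β : Type w} {t : β → ι} (e : α → β) (h : ∀ a, t (e a) = s a)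
      (x : ∀ b, C.carrier (t b)),
      C.Sat (φ.relabel e h) x ↔ C.Sat φ (fun a => h a ▸ x (e a)) := by
  induction φ with
  | falsum => intros; rfl
  | eq t₁ t₂ => intro β t e h x; simp only [Formula.relabel, Sat, val_relabel]
  | rel R ts => intro β t e h x; simp only [Formula.relabel, Sat, val_relabel]
  | imp φ ψ ih₁ ih₂ => intro β t e h x; simp only [Formula.relabel, Sat, ih₁, ih₂]
  | all j φ ih =>
    intro β t e h x
    simp only [Formula.relabel, Sat, ih]
    refine forall_congr' fun y => Eq.to_iff (congrArg _ ?_)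
    funext o
    cases o <;> rfl

/-- Truth of formulas is invariant under automorphisms. -/
theorem sat_automorphism {g : ∀ j, Equiv.Perm (C.carrier j)} (hg : C.IsAutomorphism g)
    {α : Type v} {s : α → ι} (φ : L.Formula s) :
    ∀ x : ∀ a, C.carrier (s a), C.Sat φ (fun a => g _ (x a)) ↔ C.Sat φ x := by
  have hval : ∀ {α : Type v} {s : α → ι} {j : ι} (t : L.Term s j) (x : ∀ a, C.carrier (s a)),
      C.val (fun a => g _ (x a)) t = g j (C.val x t) := by
    intro α s j t x
    induction t with
    | var a => rfl
    | app f ts ih => simp only [val, ih, hg.1]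
  induction φ with
  | falsum => intro x; rfl
  | eq t₁ t₂ => intro x; simp only [Sat, hval, EmbeddingLike.apply_eq_iff_eq]
  | rel R ts => intro x; simp only [Sat, hval]; exact hg.2 R _
  | imp φ ψ ih₁ ih₂ => intro x; simp only [Sat, ih₁, ih₂]
  | all j φ ih =>
    intro x
    simp only [Sat]
    rw [← (g j).forall_congr_right]
    refine forall_congr' fun y => ?_
    rw [← ih (C.extendVal x y)]
    refine Eq.to_iff (congrArg _ ?_)
    funext o
    cases o <;> rfl

end Str

namespace Formula

variable {α : Type v} {s : α → ι}

/-- Negation. -/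
abbrev neg (φ : L.Formula s) : L.Formula s := .imp φ .falsum

/-- The iterated implication `l₁ → l₂ → ⋯ → φ`. -/
def imps (l : List (L.Formula s)) (φ : L.Formula s) : L.Formula s := l.foldr .imp φ

theorem sat_imps (C : L.Str) (l : List (L.Formula s)) (φ : L.Formula s)
    (x : ∀ a, C.carrier (s a)) :
    C.Sat (imps l φ) x ↔ ((∀ ψ ∈ l, C.Sat ψ x) → C.Sat φ x) := by
  induction l with
  | nil => simp [imps]
  | cons ψ l ih =>
    rw [show imps (ψ :: l) φ = .imp ψ (imps l φ) from rfl, Str.Sat, ih]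
    simp

/-- A formula of `L` as a formula in the language of pairs. -/
def toPair {α : Type v} {s : α → ι} : L.Formula s → (withPred L).Formula s
  | .falsum => .falsum
  | .eq t₁ t₂ => .eq (go t₁) (go t₂)
  | .rel R ts => .rel (L := withPred L) (PairRel.base R) fun i => go (ts i)
  | .imp φ ψ => .imp φ.toPair ψ.toPair
  | .all j φ => .all j φ.toPair
where
  /-- A term of `L` as a term in the language of pairs. -/
  go {α : Type v} {s : α → ι} {j : ι} : L.Term s j → (withPred L).Term s j
    | .var a => .var a
    | .app f ts => .app (L := withPred L) f fun i => go (ts i)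

end Formula

namespace Str

theorem sat_toPair {C : L.Str} (M : C.Substr) (K : C.SSet) {α : Type v} {s : α → ι}
    (φ : L.Formula s) :
    ∀ x : ∀ a, M.set (s a), (M.pair K).Sat φ.toPair x ↔ M.toStr.Sat φ x := by
  have hval : ∀ {α : Type v} {s : α → ι} (x : ∀ a, M.set (s a)) {j : ι} (t : L.Term s j),
      (M.pair K).val x (Formula.toPair.go t) = M.toStr.val x t := by
    intro α s x j t
    induction t with
    | var a => rfl
    | app f ts ih =>
      simp only [Formula.toPair.go, val]
      exact congrArg (M.toStr.fn f) (funext ih)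
  induction φ with
  | falsum => intro x; rfl
  | eq t₁ t₂ =>
    intro x
    simp only [Formula.toPair, Sat, hval]
    rfl
  | rel R ts =>
    intro x
    simp only [Formula.toPair, Sat, hval]
    rfl
  | imp φ ψ ih₁ ih₂ => intro x; simp only [Formula.toPair, Sat, ih₁, ih₂]
  | all j φ ih =>
    intro x
    simp only [Formula.toPair, Sat]
    refine forall_congr' fun y => (Eq.to_iff (congrArg _ ?_)).trans (ih (M.toStr.extendVal x y))
    funext o
    cases o <;> rfl

section Definable

variable (C : L.Str)

/-- Renaming variables: the sorts of the new variables agree only propositionally. -/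
theorem Definable.relabel {C : L.Str} {α : Type v} {β : Type w} {s : α → ι} {t : β → ι}
    {D : Set (∀ a, C.carrier (s a))} (hD : C.Definable s D) (e : α → β)
    (h : ∀ a, t (e a) = s a) :
    C.Definable t {x | (fun a => (h a ▸ x (e a) : C.carrier (s a))) ∈ D} := by
  obtain ⟨φ, hφ⟩ := hD
  exact ⟨φ.relabel e h, fun x => (hφ _).trans (C.sat_relabel φ e h x).symm⟩

theorem Definable.imp {C : L.Str} {α : Type v} {s : α → ι} {D E : Set (∀ a, C.carrier (s a))}
    (hD : C.Definable s D) (hE : C.Definable s E) :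
    C.Definable s {x | x ∈ D → x ∈ E} := by
  obtain ⟨φ, hφ⟩ := hD
  obtain ⟨ψ, hψ⟩ := hE
  exact ⟨.imp φ ψ, fun x => imp_congr (hφ x) (hψ x)⟩

theorem definable_empty {α : Type v} (s : α → ι) : C.Definable s ∅ :=
  ⟨.falsum, fun _ => Iff.rfl⟩

theorem Definable.all {C : L.Str} {α : Type v} {s : α → ι} {j : ι}
    {D : Set (∀ o, C.carrier (extend s j o))} (hD : C.Definable (extend s j) D) :
    C.Definable s {x | ∀ y, C.extendVal x y ∈ D} := by
  obtain ⟨φ, hφ⟩ := hD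
  exact ⟨.all j φ, fun x => forall_congr' fun y => hφ _⟩

/-- An assignment of values to the disjoint union of two families of variables. -/
def sumVal {C : L.Str} {α : Type v} {β : Type w} {s : α → ι} {t : β → ι}
    (x : ∀ a, C.carrier (s a)) (y : ∀ b, C.carrier (t b)) :
    ∀ c, C.carrier (Sum.elim s t c)
  | .inl a => x a
  | .inr b => y b

/-- Universal quantification over finitely many variables. -/
theorem Definable.all_finite {C : L.Str} {α : Type v} {β : Type w} [Finite β] {s : α → ι}
    {t : β → ι}
    {D : Set (∀ c, C.carrier (Sum.elim s t c))} (hD : C.Definable (Sum.elim s t) D) :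
    C.Definable s {x | ∀ y, sumVal x y ∈ D} := by
  have key : ∀ (n : ℕ) {α : Type v} {s : α → ι} (t : Fin n → ι)
      (D : Set (∀ c, C.carrier (Sum.elim s t c))), C.Definable (Sum.elim s t) D →
      C.Definable s {x | ∀ y, sumVal x y ∈ D} := by
    intro n
    induction n with
    | zero =>
      intro α s t D hD
      convert hD.relabel (t := s) (Sum.elim id Fin.elim0) (by rintro (a | i); rfl; exact i.elim0)
        using 1
      ext x
      have hx : ∀ y : ∀ b, C.carrier (t b), (sumVal x y : ∀ c, C.carrier (Sum.elim s t c)) =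
          fun a => ((show ∀ a, s (Sum.elim id Fin.elim0 a) = Sum.elim s t a by
            rintro (a | i); rfl; exact i.elim0) a ▸ x (Sum.elim id Fin.elim0 a)) := by
        intro y; funext c; rcases c with a | i
        · rfl
        · exact i.elim0
      constructor
      · intro h; have := h (fun i => i.elim0); rw [hx] at this; exact this
      · intro h y; rw [hx]; exact h
    | succ n ih =>
      intro α s t D hD
      let e : α ⊕ Fin (n + 1) → Option α ⊕ Fin n :=
        Sum.elim (fun a => .inl (some a)) (Fin.cases (.inl none) fun i => .inr i)
      have he : ∀ c, Sum.elim (extend s (t 0)) (fun i : Fin n => t i.succ) (e c) =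
          Sum.elim s t c := by
        rintro (a | i)
        · rfl
        · refine Fin.cases ?_ (fun i => ?_) i <;> rfl
      convert (ih (fun i => t i.succ) _ (hD.relabel e he)).all using 1
      ext x
      simp only [Set.mem_ofPred_eq]
      rw [(Fin.consEquiv fun i => C.carrier (t i)).symm.forall_congr_left]
      rw [Prod.forall]
      refine forall_congr' fun y => forall_congr' fun z => Eq.to_iff (congrArg (· ∈ D) ?_)
      funext c
      rcases c with a | i
      · rfl
      · refine Fin.cases ?_ (fun i => ?_) i <;> rfl
  obtain ⟨n, ⟨e⟩⟩ := Finite.exists_equiv_fin β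
  obtain ⟨t, rfl⟩ : ∃ t' : Fin n → ι, t = t' ∘ e := ⟨t ∘ e.symm, by ext; simp⟩
  convert key n t _ (hD.relabel (t := Sum.elim s t) (Sum.map id e) (by rintro (a | b) <;> rfl))
    using 1
  ext x
  simp only [Set.mem_ofPred_eq]
  refine (Equiv.piCongrLeft (fun i => C.carrier (t i)) e).symm.surjective.forall.trans ?_
  refine forall_congr' fun y => Eq.to_iff (congrArg (· ∈ D) ?_)
  funext c
  rcases c with a | b <;> rfl

end Definable
end Str
end SortedLanguage

namespace SortedLanguage
namespace Str

variable {ι : Type u} {L : SortedLanguage ι}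

/-! ### Definable predicates on finite products of sorts -/

/-- A type identified with a finite product of sorts of the structure `C`. -/
class DSpace (C : L.Str) (Ω : Type u) where
  /-- The indices of the coordinates. -/
  Idx : Type
  /-- There are finitely many coordinates. -/
  finite_idx : Finite Idx
  /-- The sorts of the coordinates. -/
  sort : Idx → ι
  /-- The identification with a product of sorts. -/
  chart : Ω ≃ ∀ a, C.carrier (sort a)

attribute [instance] DSpace.finite_idx

open DSpace

variable (C : L.Str)

instance DSpace.carrier (j : ι) : DSpace C (C.carrier j) where
  Idx := Unit
  finite_idx := inferInstance
  sort _ := j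
  chart := ⟨fun y _ => y, fun f => f (), fun _ => rfl, fun _ => rfl⟩

instance DSpace.prod {Ω Θ : Type u} [DSpace C Ω] [DSpace C Θ] : DSpace C (Ω × Θ) where
  Idx := Idx C Ω ⊕ Idx C Θ
  finite_idx := inferInstance
  sort := Sum.elim (sort (C := C) (Ω := Ω)) (sort (C := C) (Ω := Θ))
  chart :=
    { toFun := fun p => sumVal (chart p.1) (chart p.2)
      invFun := fun x => (chart.symm fun a => x (.inl a), chart.symm fun a => x (.inr a))
      left_inv := fun p => by simp [sumVal]
      right_inv := fun x => by
        funext c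
        rcases c with a | b
        exacts [congrFun (chart.apply_symm_apply _) a, congrFun (chart.apply_symm_apply _) b] }

instance DSpace.pi {I : Type} [Finite I] {Ω : I → Type u} [∀ i, DSpace C (Ω i)] :
    DSpace C (∀ i, Ω i) where
  Idx := Σ i, Idx C (Ω i)
  finite_idx := inferInstance
  sort p := sort (C := C) (Ω := Ω p.1) p.2
  chart :=
    { toFun := fun x p => chart (x p.1) p.2
      invFun := fun x i => chart.symm fun a => x ⟨i, a⟩
      left_inv := fun p => by funext i; exact chart.symm_apply_apply (p i)
      right_inv := fun x => by funext c; simp }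

/-- Definable predicates without parameters. -/
def Def {Ω : Type u} [DSpace C Ω] (P : Ω → Prop) : Prop :=
  C.Definable (sort (C := C) (Ω := Ω)) {x | P (chart.symm x)}

/-- Maps all of whose coordinates are coordinates of the argument. -/
def Reindex {Ω Θ : Type u} [DSpace C Ω] [DSpace C Θ] (f : Ω → Θ) : Prop :=
  ∃ e : Idx C Θ → Idx C Ω, (∀ a, sort (C := C) (Ω := Ω) (e a) = sort (C := C) (Ω := Θ) a) ∧
    ∀ ω a, HEq (chart (C := C) (f ω) a) (chart (C := C) ω (e a))

variable {C} {Ω Θ Ξ : Type u} [DSpace C Ω] [DSpace C Θ] [DSpace C Ξ]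

theorem Definable.of_def {P : Ω → Prop} (hP : C.Def P) {β : Type w} {t : β → ι}
    (f : (∀ b, C.carrier (t b)) → Ω) (e : Idx C Ω → β)
    (h : ∀ a, t (e a) = sort (C := C) (Ω := Ω) a)
    (hf : ∀ x a, HEq (chart (C := C) (f x) a) (x (e a))) :
    C.Definable t {x | P (f x)} := by
  convert Definable.relabel hP e h using 1
  ext x
  refine Eq.to_iff (congrArg P ?_)
  rw [Equiv.eq_symm_apply]
  funext a
  exact eq_of_heq ((hf x a).trans (eqRec_heq _ _).symm)

theorem Def.of_definable {β : Type w} {t : β → ι} {D : Set (∀ b, C.carrier (t b))}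
    (hD : C.Definable t D) (f : Ω → ∀ b, C.carrier (t b)) (e : β → Idx C Ω)
    (h : ∀ b, sort (C := C) (Ω := Ω) (e b) = t b)
    (hf : ∀ ω b, HEq (f ω b) (chart (C := C) ω (e b))) : C.Def fun ω => f ω ∈ D := by
  unfold Def
  convert Definable.relabel hD e h using 1
  ext x
  refine Eq.to_iff (congrArg (· ∈ D) ?_)
  funext b
  refine eq_of_heq ((hf _ b).trans ?_)
  rw [Equiv.apply_symm_apply]
  exact (eqRec_heq _ _).symm

theorem Def.comp {P : Θ → Prop} (hP : C.Def P) {f : Ω → Θ} (hf : C.Reindex f) :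
    C.Def fun ω => P (f ω) := by
  obtain ⟨e, h, he⟩ := hf
  refine Definable.of_def hP (fun x => f (chart.symm x)) e h fun x a => ?_
  refine (he _ _).trans ?_
  rw [Equiv.apply_symm_apply]

namespace Reindex

theorem id : C.Reindex (fun ω : Ω => ω) := ⟨_root_.id, fun _ => rfl, fun _ _ => HEq.rfl⟩

theorem fst : C.Reindex (Prod.fst : Ω × Θ → Ω) := ⟨Sum.inl, fun _ => rfl, fun _ _ => HEq.rfl⟩

theorem snd : C.Reindex (Prod.snd : Ω × Θ → Θ) := ⟨Sum.inr, fun _ => rfl, fun _ _ => HEq.rfl⟩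

theorem comp {f : Ω → Θ} {g : Θ → Ξ} (hg : C.Reindex g) (hf : C.Reindex f) :
    C.Reindex fun ω => g (f ω) := by
  obtain ⟨e, h, he⟩ := hf
  obtain ⟨e', h', he'⟩ := hg
  exact ⟨fun a => e (e' a), fun a => (h _).trans (h' a), fun ω a => (he' _ _).trans (he _ _)⟩

theorem fst' {f : Ω → Θ × Ξ} (hf : C.Reindex f) : C.Reindex fun ω => (f ω).1 := fst.comp hf

theorem snd' {f : Ω → Θ × Ξ} (hf : C.Reindex f) : C.Reindex fun ω => (f ω).2 := snd.comp hf

theorem pair {f : Ω → Θ} {g : Ω → Ξ} (hf : C.Reindex f) (hg : C.Reindex g) :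
    C.Reindex fun ω => (f ω, g ω) := by
  obtain ⟨e, h, he⟩ := hf
  obtain ⟨e', h', he'⟩ := hg
  refine ⟨Sum.elim e e', ?_, ?_⟩
  · rintro (a | a)
    exacts [h a, h' a]
  · rintro ω (a | a)
    exacts [he ω a, he' ω a]

variable {I : Type} [Finite I] {Ψ : I → Type u} [∀ i, DSpace C (Ψ i)]

theorem pi {f : ∀ i, Ω → Ψ i} (hf : ∀ i, C.Reindex (f i)) : C.Reindex fun ω i => f i ω := by
  choose e h he using hf
  exact ⟨fun p => e p.1 p.2, fun p => h p.1 p.2, fun ω p => he p.1 ω p.2⟩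

theorem eval {f : Ω → ∀ i, Ψ i} (hf : C.Reindex f) (i : I) : C.Reindex fun ω => f ω i :=
  have h : C.Reindex fun x : ∀ i, Ψ i => x i :=
    ⟨fun a => ⟨i, a⟩, fun _ => rfl, fun _ _ => HEq.rfl⟩
  h.comp hf

end Reindex

namespace Def

theorem congr {P Q : Ω → Prop} (hP : C.Def P) (h : ∀ ω, Q ω ↔ P ω) : C.Def Q := by
  rwa [show Q = P from funext fun ω => propext (h ω)]

theorem false : C.Def fun _ : Ω => False := definable_empty C _

theorem imp {P Q : Ω → Prop} (hP : C.Def P) (hQ : C.Def Q) : C.Def fun ω => P ω → Q ω :=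
  Definable.imp hP hQ

theorem not {P : Ω → Prop} (hP : C.Def P) : C.Def fun ω => ¬ P ω := hP.imp false

theorem true : C.Def fun _ : Ω => True := false.not.congr (by simp)

theorem and {P Q : Ω → Prop} (hP : C.Def P) (hQ : C.Def Q) : C.Def fun ω => P ω ∧ Q ω :=
  (hP.imp hQ.not).not.congr (by simp)

theorem or {P Q : Ω → Prop} (hP : C.Def P) (hQ : C.Def Q) : C.Def fun ω => P ω ∨ Q ω :=
  (hP.not.imp hQ).congr fun ω => by tauto

theorem all {P : Ω → Θ → Prop} (hP : C.Def fun p : Ω × Θ => P p.1 p.2) :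
    C.Def fun ω => ∀ θ, P ω θ := by
  unfold Def
  convert Definable.all_finite hP using 1
  ext x
  refine (chart (C := C)).symm.surjective.forall.trans ?_
  exact Iff.rfl

theorem ex {P : Ω → Θ → Prop} (hP : C.Def fun p : Ω × Θ => P p.1 p.2) :
    C.Def fun ω => ∃ θ, P ω θ :=
  (all (P := fun ω θ => ¬ P ω θ) hP.not).not.congr (by simp)

theorem all_finite {I : Type*} [Finite I] {P : I → Ω → Prop} (hP : ∀ i, C.Def (P i)) :
    C.Def fun ω => ∀ i, P i ω := by
  have key : ∀ n (P : Fin n → Ω → Prop), (∀ i, C.Def (P i)) → C.Def fun ω => ∀ i, P i ω := by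
    intro n
    induction n with
    | zero => intro P _; exact true.congr (by simp)
    | succ n ih =>
      intro P hP
      exact ((hP 0).and (ih (fun i => P i.succ) fun i => hP _)).congr
        fun ω => Fin.forall_fin_succ
  obtain ⟨n, ⟨e⟩⟩ := Finite.exists_equiv_fin I
  exact (key n (fun i => P (e.symm i)) fun i => hP _).congr fun ω => by
    rw [e.symm.surjective.forall]

theorem ex_finite {I : Type*} [Finite I] {P : I → Ω → Prop} (hP : ∀ i, C.Def (P i)) :
    C.Def fun ω => ∃ i, P i ω :=
  (all_finite fun i => (hP i).not).not.congr (by simp)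

theorem eq {f g : Ω → Θ} (hf : C.Reindex f) (hg : C.Reindex g) : C.Def fun ω => f ω = g ω := by
  have h0 : ∀ j : ι, C.Def fun p : C.carrier j × C.carrier j => p.1 = p.2 := fun j =>
    ⟨.eq (j := j) (.var (s := Sum.elim (fun _ : Unit => j) fun _ : Unit => j) (.inl ()))
      (.var (s := Sum.elim (fun _ : Unit => j) fun _ : Unit => j) (.inr ())), fun _ => Iff.rfl⟩
  have hc : ∀ a, C.Reindex fun θ : Θ => chart (C := C) θ a := fun a =>
    ⟨fun _ => a, fun _ => rfl, fun _ _ => HEq.rfl⟩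
  refine (all_finite fun a => (h0 _).comp
    (((hc a).comp hf).pair ((hc a).comp hg))).congr fun ω => ?_
  rw [← (chart (C := C)).injective.eq_iff, funext_iff]

end Def

/-- The element of `C` underlying an element of the pair `(M, K)`. -/
def Substr.pt {C : L.Str} (M : C.Substr) (K : C.SSet) {j : ι} (x : (M.pair K).carrier j) :
    C.carrier j :=
  Subtype.val x

theorem Substr.pt_injective {C : L.Str} (M : C.Substr) (K : C.SSet) {j : ι} :
    Function.Injective (M.pt K (j := j)) :=
  Subtype.val_injective

theorem Substr.exists_pt {C : L.Str} (M : C.Substr) (K : C.SSet) {j : ι} {y : C.carrier j}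
    (hy : y ∈ M.set j) : ∃ x : (M.pair K).carrier j, M.pt K x = y :=
  ⟨⟨y, hy⟩, rfl⟩

/-- Predicates definable in `C` restrict to definable predicates in the pair `(M, K)`. -/
theorem Definable.toPair {M : C.Substr} (hM : M.IsElementary) (K : C.SSet) {α : Type}
    {s : α → ι} {D : Set (∀ a, C.carrier (s a))} (hD : C.Definable s D) :
    (M.pair K).Definable s {x | (fun a => M.pt K (x a)) ∈ D} := by
  obtain ⟨φ, hφ⟩ := hD
  refine ⟨φ.toPair, fun x => Iff.trans ?_ (sat_toPair M K φ x).symm⟩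
  have h1 := C.sat_relabel φ (β := ULift.{u} α) (t := fun a => s a.down) ULift.up (fun _ => rfl)
    (fun a => M.pt K (x a.down))
  have h2 := M.toStr.sat_relabel φ (β := ULift.{u} α) (t := fun a => s a.down) ULift.up
    (fun _ => rfl) (fun a => x a.down)
  exact (hφ _).trans (h1.symm.trans (Iff.trans (hM _ _ _ _).symm h2))

theorem def_mem_pred (M : C.Substr) (K : C.SSet) (j : ι) :
    (M.pair K).Def fun x : (M.pair K).carrier j => M.pt K x ∈ K j :=
  ⟨.rel (L := withPred L) (J := [j]) (PairRel.pred j) (Fin.cases (.var ()) fun i => i.elim0),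
    fun _ => Iff.rfl⟩

end Str
end SortedLanguage

namespace SortedLanguage
namespace Str

variable {ι : Type u} {L : SortedLanguage ι} {C : L.Str}

/-! ### Automorphisms over small sets -/

/-- The subset obtained by adding the elements in `F` to `A`. -/
def adjoin (A : C.SSet) (F : Set (Σ j, C.carrier j)) : C.SSet :=
  fun j => A j ∪ {y | (⟨j, y⟩ : Σ j, C.carrier j) ∈ F}

theorem mk_adjoin_lt {κ : Cardinal.{u}} (hκ : ℵ₀ ≤ κ) {A : C.SSet} (hA : #A.Elem < κ)
    {F : Set (Σ j, C.carrier j)} (hF : F.Finite) : #(adjoin A F).Elem < κ := by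
  refine lt_of_le_of_lt (b := #(A.Elem ⊕ F)) ?_ ?_
  · let f : A.Elem ⊕ F → (adjoin A F).Elem :=
      Sum.elim (fun p => ⟨p.1, p.2.1, Or.inl p.2.2⟩) fun p => ⟨p.1.1, p.1.2, Or.inr p.2⟩
    refine mk_le_of_surjective (f := f) ?_
    rintro ⟨j, y, hy | hy⟩
    · exact ⟨.inl ⟨j, y, hy⟩, rfl⟩
    · exact ⟨.inr ⟨⟨j, y⟩, hy⟩, rfl⟩
  · rw [mk_sum, lift_id, lift_id]
    exact add_lt_of_lt hκ hA ((lt_aleph0_iff_set_finite.2 hF).trans_le hκ)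

variable (C) in
/-- The group of automorphisms of `C` that fix `A` pointwise. -/
def autFix (A : C.SSet) : Subgroup (∀ j, Equiv.Perm (C.carrier j)) where
  carrier := {g | C.IsAutomorphism g ∧ ∀ j, ∀ x ∈ A j, g j x = x}
  one_mem' := ⟨⟨fun _ _ => rfl, fun _ _ => Iff.rfl⟩, fun _ _ _ => rfl⟩
  mul_mem' := by
    rintro g h ⟨⟨hg1, hg2⟩, hg⟩ ⟨⟨hh1, hh2⟩, hh⟩
    refine ⟨⟨fun f x => ?_, fun R x => ?_⟩, fun j x hx => ?_⟩
    · simp only [Pi.mul_apply, Equiv.Perm.mul_apply, hh1, hg1]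
    · exact (hg2 R fun i => h _ (x i)).trans (hh2 R x)
    · simp only [Pi.mul_apply, Equiv.Perm.mul_apply, hh j x hx, hg j x hx]
  inv_mem' := by
    rintro g ⟨⟨hg1, hg2⟩, hg⟩
    refine ⟨⟨fun f x => ?_, fun R x => ?_⟩, fun j x hx => ?_⟩
    · simp only [Pi.inv_apply]
      rw [Equiv.Perm.inv_eq_iff_eq, hg1]
      simp
    · rw [← hg2]
      simp
    · simp only [Pi.inv_apply]
      rw [Equiv.Perm.inv_eq_iff_eq, hg j x hx]

theorem IsMonster.exists_extension {κ : Cardinal.{u}} (hC : C.IsMonster κ) {A X : C.SSet}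
    (hA : #A.Elem < κ) (hAX : A ≤ X) {f : ∀ j, X j → C.carrier j} (hf : C.IsElementaryMap X f)
    (hfix : ∀ j (x : X j), x.1 ∈ A j → f j x = x.1) {γ : Type w} [Finite γ] {s : γ → ι}
    (x : ∀ c, X (s c)) : ∃ g ∈ C.autFix A, ∀ c, g _ (x c).1 = f _ (x c) := by
  set F : Set (Σ j, C.carrier j) := Set.range fun c => ⟨s c, (x c).1⟩ with hF
  have hsub : ∀ j, ∀ y ∈ adjoin A F j, y ∈ X j := by
    rintro j y (hy | ⟨c, hc⟩)
    · exact hAX j hy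
    · obtain ⟨rfl, hc⟩ := Sigma.mk.inj_iff.1 hc
      exact eq_of_heq hc ▸ (x c).2
  obtain ⟨g, hg, hgf⟩ := hC.homogeneous (adjoin A F) (fun j y => f j ⟨y.1, hsub j _ y.2⟩)
    (mk_adjoin_lt hC.aleph0_lt.le hA (Set.finite_range _))
    fun α t φ y => hf α t φ fun a => ⟨(y a).1, hsub _ _ (y a).2⟩
  refine ⟨g, ⟨hg, fun j y hy => ?_⟩, fun c => ?_⟩
  · exact (hgf j ⟨y, Or.inl hy⟩).trans (hfix j _ hy)
  · exact hgf _ ⟨(x c).1, Or.inr ⟨c, rfl⟩⟩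

/-- If `y` satisfies all formulas over a small set `A` that hold of `x`, then an automorphism
over `A` moves `x` to `y`. -/
theorem IsMonster.exists_automorphism_of_type {κ : Cardinal.{u}} (hC : C.IsMonster κ)
    {A : C.SSet} (hA : #A.Elem < κ) {j : ι} {x y : C.carrier j}
    (h : ∀ φ, x ∈ C.solutions A j φ → y ∈ C.solutions A j φ) : ∃ g ∈ C.autFix A, g j x = y := by
  classical
  have h' : ∀ φ, x ∈ C.solutions A j φ ↔ y ∈ C.solutions A j φ := fun φ =>
    ⟨h φ, fun hy => by_contra fun hx => h (.neg φ) hx hy⟩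
  by_cases hxA : x ∈ A j
  · -- the formula `v = x` has a parameter in `A`, so that `y = x`
    let φ : L.Formula (withParams (fun _ : Unit => j) A) :=
      .eq (j := j) (.var (s := withParams (fun _ : Unit => j) A) (.inl ()))
        (.var (s := withParams (fun _ : Unit => j) A) (.inr ⟨j, x, hxA⟩))
    have hyx : y = x := (h' φ).1 (rfl : x = x)
    exact ⟨1, one_mem _, hyx.symm⟩
  set B := adjoin A {⟨j, x⟩} with hB
  have hBx : ∀ j' (z : B j'), z.1 ∉ A j' → (⟨j', z.1⟩ : Σ j, C.carrier j) = ⟨j, x⟩ :=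
    fun j' z hz => z.2.resolve_left hz
  have hBj : ∀ j' (z : B j'), z.1 ∉ A j' → j = j' :=
    fun j' z hz => (congrArg Sigma.fst (hBx j' z hz)).symm
  let f : ∀ j', B j' → C.carrier j' := fun j' z =>
    if hz : z.1 ∈ A j' then z.1 else hBj j' z hz ▸ y
  have hf : C.IsElementaryMap B f := by
    intro α s φ v
    -- the renaming that turns `φ(v)` into a formula over `A`, in which `x` is replaced
    -- by the free variable
    let e : α → Unit ⊕ A.Elem := fun a =>
      if hz : (v a).1 ∈ A (s a) then .inr ⟨s a, (v a).1, hz⟩ else .inl ()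
    have he : ∀ a, withParams (fun _ : Unit => j) A (e a) = s a := by
      intro a
      by_cases hz : (v a).1 ∈ A (s a)
      · simp only [e, dif_pos hz, withParams]
      · simp only [e, dif_neg hz, withParams]
        exact (congrArg Sigma.fst (hBx _ _ hz)).symm
    have key : ∀ (z : C.carrier j) a, HEq (withParamsVal A (fun _ : Unit => z) (e a))
        (if hz : (v a).1 ∈ A (s a) then (v a).1 else
          hBj _ (v a) hz ▸ z) := by
      intro z a
      by_cases hz : (v a).1 ∈ A (s a)
      · have : e a = .inr ⟨s a, (v a).1, hz⟩ := by simp only [e, dif_pos hz]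
        rw [this, dif_pos hz]
        rfl
      · have : e a = .inl () := by simp only [e, dif_neg hz]
        rw [this, dif_neg hz]
        exact (eqRec_heq _ _).symm
    have h1 := C.sat_relabel φ e he (withParamsVal A fun _ : Unit => x)
    have h2 := C.sat_relabel φ e he (withParamsVal A fun _ : Unit => y)
    rw [show (fun a => (he a ▸ withParamsVal A (fun _ : Unit => x) (e a) : C.carrier (s a))) =
      fun a => (v a).1 from ?_] at h1
    · rw [show (fun a => (he a ▸ withParamsVal A (fun _ : Unit => y) (e a) : C.carrier (s a))) =
        fun a => f _ (v a) from ?_] at h2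
      · exact h1.symm.trans ((h' _).trans h2)
      · funext a
        exact eq_of_heq ((eqRec_heq _ _).trans (key y a))
    · funext a
      refine eq_of_heq ((eqRec_heq _ _).trans ((key x a).trans ?_))
      by_cases hz : (v a).1 ∈ A (s a)
      · rw [dif_pos hz]
      · rw [dif_neg hz]
        exact (eqRec_heq _ _).trans (Sigma.mk.inj_iff.1 (hBx _ _ hz)).2.symm
  obtain ⟨g, hg, hgf⟩ := hC.homogeneous B f
    (mk_adjoin_lt hC.aleph0_lt.le hA (Set.finite_singleton _)) hf
  refine ⟨g, ⟨hg, fun j z hz => ?_⟩, ?_⟩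
  · exact (hgf j ⟨z, Or.inl hz⟩).trans (dif_pos hz)
  · exact (hgf j ⟨x, Or.inr rfl⟩).trans (dif_neg hxA)

/-- An element whose orbit over a small set `A` is contained in a finite set satisfies a formula
over `A` all of whose solutions lie in that finite set. -/
theorem IsMonster.exists_formula_of_orbit_subset {κ : Cardinal.{u}} (hC : C.IsMonster κ)
    {A : C.SSet} (hA : #A.Elem < κ) {j : ι} {x : C.carrier j} {O : Set (C.carrier j)}
    (hO : O.Finite) (h : ∀ g ∈ C.autFix A, g j x ∈ O) :
    ∃ φ, x ∈ C.solutions A j φ ∧ C.solutions A j φ ⊆ O := by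
  by_contra! hcon
  set B := adjoin A (Sigma.mk j '' O) with hB
  -- the type over `B` of the realizations outside `O` of the type of `x` over `A`
  let p : Set (L.Formula (withParams (fun _ : Unit => j) B)) :=
    {ψ | ∃ φ, x ∈ C.solutions A j φ ∧ ∀ y ∈ C.solutions A j φ, y ∉ O → y ∈ C.solutions B j ψ}
  have hp : ∀ q ⊆ p, q.Finite → ∃ φ, x ∈ C.solutions A j φ ∧
      ∀ ψ ∈ q, ∀ y ∈ C.solutions A j φ, y ∉ O → y ∈ C.solutions B j ψ := by
    intro q hq hfin
    induction q, hfin using Set.Finite.induction_on with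
    | empty => exact ⟨.neg .falsum, fun h => h, by simp⟩
    | @insert ψ q _ _ ih =>
      obtain ⟨φ, hφ, hφ'⟩ := ih ((Set.subset_insert _ _).trans hq)
      obtain ⟨χ, hχ, hχ'⟩ := hq (Set.mem_insert _ _)
      refine ⟨.neg (.imp φ (.neg χ)), fun h => h hφ hχ, fun θ hθ y hy hyO => ?_⟩
      have hy' : y ∈ C.solutions A j φ ∧ y ∈ C.solutions A j χ := by
        by_contra hcon
        exact hy fun h1 h2 => hcon ⟨h1, h2⟩
      rcases hθ with rfl | hθ
      · exact hχ' y hy'.2 hyO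
      · exact hφ' θ hθ y hy'.1 hyO
  obtain ⟨y, hy⟩ := hC.saturated B (mk_adjoin_lt hC.aleph0_lt.le hA (hO.image _)) Unit
    (fun _ => j) p (by
      intro q hq hfin
      obtain ⟨φ, hφ, hφ'⟩ := hp q hq hfin
      obtain ⟨y, hy, hyO⟩ := Set.not_subset.1 (hcon φ hφ)
      exact ⟨fun _ => y, fun ψ hψ => hφ' ψ hψ y hy hyO⟩)
  have hyO : y () ∉ O := by
    intro hyO
    refine hy (.neg (.eq (.var (.inl ())) (.var (s := withParams (fun _ : Unit => j) B)
      (.inr ⟨j, y (), Or.inr ⟨_, hyO, rfl⟩⟩)))) ⟨.neg .falsum, fun h => h, ?_⟩ rfl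
    intro z _ hz hzy
    exact hz ((show z = y () from hzy) ▸ hyO)
  obtain ⟨g, hg, hgx⟩ := hC.exists_automorphism_of_type hA (x := x) (y := y ()) (by
    intro φ hφ
    let e : Unit ⊕ A.Elem → Unit ⊕ B.Elem :=
      Sum.map _root_.id fun p => ⟨p.1, p.2.1, Or.inl p.2.2⟩
    have he : ∀ c, withParams (fun _ : Unit => j) B (e c) = withParams (fun _ : Unit => j) A c := by
      rintro (c | c) <;> rfl
    have key : ∀ z : C.carrier j, z ∈ C.solutions B j (φ.relabel e he) ↔
        z ∈ C.solutions A j φ := by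
      intro z
      refine (C.sat_relabel φ e he _).trans (Eq.to_iff (congrArg (C.Sat φ) ?_))
      funext c
      rcases c with c | c <;> rfl
    exact (key _).1 (hy _ ⟨φ, hφ, fun z hz _ => (key z).2 hz⟩))
  exact hyO (hgx ▸ h g hg)

theorem autFix_solutions {A : C.SSet} {g : ∀ j, Equiv.Perm (C.carrier j)} (hg : g ∈ C.autFix A)
    {j : ι} {φ} {x : C.carrier j} : g j x ∈ C.solutions A j φ ↔ x ∈ C.solutions A j φ := by
  refine Iff.trans (Eq.to_iff (congrArg (C.Sat φ) ?_)) (C.sat_automorphism hg.1 φ _)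
  funext c
  rcases c with c | c
  · rfl
  · exact (hg.2 _ _ c.2.2).symm

variable {κ : Cardinal.{u}} {K : C.SSet}

theorem IsMonster.mem_dcl_of_fixed (hC : C.IsMonster κ) (hK : #K.Elem < κ) {j : ι}
    {x : C.carrier j} (h : ∀ g ∈ C.autFix K, g j x = x) : x ∈ C.dcl K j := by
  obtain ⟨φ, hφ, hsub⟩ := hC.exists_formula_of_orbit_subset hK (Set.finite_singleton x) h
  exact ⟨φ, hsub.antisymm (Set.singleton_subset_iff.2 hφ)⟩

theorem IsMonster.mem_acl_of_finite_orbit (hC : C.IsMonster κ) (hK : #K.Elem < κ) {j : ι}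
    {x : C.carrier j} {O : Set (C.carrier j)} (hO : O.Finite)
    (h : ∀ g ∈ C.autFix K, g j x ∈ O) : x ∈ C.acl K j := by
  obtain ⟨φ, hφ, hsub⟩ := hC.exists_formula_of_orbit_subset hK hO h
  exact ⟨φ, hφ, hO.subset hsub⟩

theorem exists_finite_orbit_of_mem_acl {j : ι} {x : C.carrier j} (hx : x ∈ C.acl K j) :
    ∃ O : Set (C.carrier j), O.Finite ∧ ∀ g ∈ C.autFix K, g j x ∈ O := by
  obtain ⟨φ, hφ, hfin⟩ := hx
  exact ⟨_, hfin, fun g hg => (autFix_solutions hg).2 hφ⟩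

theorem autFix_mem_acl {g : ∀ j, Equiv.Perm (C.carrier j)} (hg : g ∈ C.autFix K) {j : ι}
    {x : C.carrier j} : g j x ∈ C.acl K j ↔ x ∈ C.acl K j := by
  refine exists_congr fun φ => and_congr_left fun _ => autFix_solutions hg

theorem dcl_le_acl (K : C.SSet) : C.dcl K ≤ C.acl K := by
  rintro j x ⟨φ, hφ⟩
  exact ⟨φ, hφ ▸ rfl, hφ ▸ Set.finite_singleton x⟩

/-- Elementary substructures are algebraically closed. -/
theorem acl_le_of_isElementary {M : C.Substr} (hM : M.IsElementary) (hKM : K ≤ M.set) :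
    C.acl K ≤ M.set := by
  rintro j x ⟨φ, hφ, hfin⟩
  by_contra hx
  set S := {m : M.set j | m.1 ∈ C.solutions K j φ} with hS
  have hSfin : S.Finite := hfin.preimage Subtype.val_injective.injOn
  let t : K.Elem ⊕ S → ι := Sum.elim Sigma.fst fun _ => j
  let y : ∀ c, M.set (t c) := fun c => match c with
    | .inl p => ⟨p.2.1, hKM _ p.2.2⟩
    | .inr m => m.1
  let e : Unit ⊕ K.Elem → Option (K.Elem ⊕ S) := Sum.elim (fun _ => none) fun p => some (.inl p)
  have he : ∀ c, extend t j (e c) = withParams (fun _ : Unit => j) K c := by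
    rintro (c | c) <;> rfl
  have := hSfin.to_subtype
  have := Fintype.ofFinite S
  -- no solution of `φ` is different from all solutions in `M`
  let ψ : L.Formula t := .all j (.imps (Finset.univ.toList.map fun m : S =>
    .neg (.eq (.var (s := extend t j) none) (.var (s := extend t j) (some (.inr m)))))
    (.neg (φ.relabel e he)))
  have hφ' : ∀ z : C.carrier j, C.Sat (φ.relabel e he)
      (C.extendVal (fun c => (y c).1) z) ↔ z ∈ C.solutions K j φ := by
    intro z
    refine (C.sat_relabel φ e he _).trans (Eq.to_iff (congrArg (C.Sat φ) ?_))
    funext c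
    rcases c with c | c <;> rfl
  have hψ : ¬ C.Sat ψ fun c => (y c).1 := by
    intro h
    refine (Formula.sat_imps C _ _ _).1 (h x) ?_ ((hφ' x).2 hφ)
    simp only [List.mem_map, forall_exists_index, and_imp]
    rintro _ m - rfl h
    exact hx ((show x = m.1.1 from h) ▸ m.1.2)
  refine hψ ((hM _ _ ψ y).1 fun z => ?_)
  refine (Formula.sat_imps _ _ _ _).2 fun hz h => ?_
  have hzS : z.1 ∈ C.solutions K j φ := by
    rw [← hφ']
    have := (hM _ _ (φ.relabel e he) (M.toStr.extendVal y z)).1 h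
    refine (Eq.to_iff (congrArg (C.Sat _) ?_)).1 this
    funext o
    cases o <;> rfl
  refine hz _ (List.mem_map.2 ⟨⟨z, hzS⟩, by simp, rfl⟩) ?_
  rfl

end Str
end SortedLanguage

namespace SortedLanguage
namespace Str

variable {ι : Type u} {L : SortedLanguage ι} {C : L.Str} {κ : Cardinal.{u}} {K : C.SSet}

/-! ### Codes of finite sets of tuples -/

theorem exists_list_equiv {γ : Type} [Finite γ] (s : γ → ι) :
    ∃ (l : List ι) (e : γ ≃ Fin l.length), s = l.get ∘ e := by
  obtain ⟨n, ⟨e⟩⟩ := Finite.exists_equiv_fin γ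
  refine ⟨List.ofFn (s ∘ e.symm), e.trans (finCongr (List.length_ofFn).symm), ?_⟩
  funext c
  simp

/-- Uniform elimination of imaginaries for tuples indexed by a finite type. -/
theorem UniformEI.exists_code (hEI : C.UniformEI) {γ : Type} [Finite γ] {s : γ → ι}
    (E : Setoid (∀ c, C.carrier (s c)))
    (hE : C.Def fun p : (∀ c, C.carrier (s c)) × (∀ c, C.carrier (s c)) => E p.1 p.2) :
    ∃ (J : List ι) (f : (∀ c, C.carrier (s c)) → C.Tup J),
      C.Definable (Sum.elim s J.get)
        {z | f (fun i => z (Sum.inl i)) = fun i => z (Sum.inr i)} ∧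
      ∀ a b, E a b ↔ f a = f b := by
  obtain ⟨l, e, rfl⟩ := exists_list_equiv s
  let r : C.Tup l → ∀ c, C.carrier ((l.get ∘ e) c) := fun x c => x (e c)
  obtain ⟨J, f, hf, hEf⟩ := hEI l (E.comap r) (by
    refine Definable.of_def hE (fun z : ∀ c, C.carrier (Sum.elim l.get l.get c) =>
      (r fun i => z (.inl i), r fun i => z (.inr i)))
      (Sum.map (fun c => e c.1) fun c => e c.1) ?_ ?_
    · rintro (c | c) <;> rfl
    · rintro x (c | c) <;> rfl)
  have hr : Function.Bijective r :=
    (Equiv.piCongrLeft (fun i => C.carrier (l.get i)) e).symm.bijective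
  obtain ⟨r', hr1, hr2⟩ := Function.bijective_iff_has_inverse.1 hr
  refine ⟨J, fun x => f (r' x), ?_, fun a b => ?_⟩
  · convert hf.relabel (t := Sum.elim (l.get ∘ e) J.get) (Sum.map e.symm _root_.id)
      (by rintro (a | b); exact congrArg l.get (e.apply_symm_apply a); rfl) using 1
    ext z
    refine Eq.to_iff (congrArg (fun y : C.Tup l => f y = fun i => z (Sum.inr i)) ?_)
    apply hr.injective
    refine (hr2 _).trans (funext fun c => ?_)
    refine eq_of_heq (HEq.trans ?_ (eqRec_heq _ _).symm)
    change HEq (z (Sum.inl c)) (z (Sum.inl (e.symm (e c))))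
    rw [e.symm_apply_apply]
  · rw [← hEf]
    change E a b ↔ E (r (r' a)) (r (r' b))
    rw [hr2, hr2]

theorem Definable.equivariant {α β : Type} {s : α → ι} {t : β → ι}
    {f : (∀ a, C.carrier (s a)) → ∀ b, C.carrier (t b)}
    (hf : C.Definable (Sum.elim s t) {z | f (fun i => z (Sum.inl i)) = fun i => z (Sum.inr i)})
    {g : ∀ j, Equiv.Perm (C.carrier j)} (hg : C.IsAutomorphism g) (x : ∀ a, C.carrier (s a)) :
    f (fun a => g _ (x a)) = fun b => g _ (f x b) := by
  obtain ⟨φ, hφ⟩ := hf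
  have h1 : C.Sat φ (sumVal x (f x)) := (hφ _).1 rfl
  exact (hφ _).2 ((C.sat_automorphism hg φ _).2 h1)

/-- Codes of finite sets: a set of at most `N` tuples, enumerated as the rows of `a`, has the
code `f a`, which depends only on the set and lies in a product of sorts that depends only on `N`
and the sorts of the tuples. -/
theorem UniformEI.exists_code_range (hEI : C.UniformEI) {γ : Type} [Finite γ] (s : γ → ι)
    (N : ℕ) :
    ∃ (J : List ι) (f : (∀ p : Fin N × γ, C.carrier (s p.2)) → C.Tup J),
      C.Definable (Sum.elim (fun p : Fin N × γ => s p.2) J.get)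
        {z | f (fun i => z (Sum.inl i)) = fun i => z (Sum.inr i)} ∧
      ∀ a b, f a = f b ↔
        (Set.range fun i c => a (i, c) : Set (∀ c, C.carrier (s c))) =
          Set.range fun i c => b (i, c) := by
  obtain ⟨J, f, hf, h⟩ := hEI.exists_code (s := fun p : Fin N × γ => s p.2)
    (Setoid.ker fun y => (Set.range fun i c => y (i, c) : Set (∀ c, C.carrier (s c)))) (by
      have h1 : ∀ i j, C.Def fun p : (∀ p : Fin N × γ, C.carrier (s p.2)) ×
          (∀ p : Fin N × γ, C.carrier (s p.2)) =>
          (fun c => p.1 (i, c)) = fun c => p.2 (j, c) := fun i j =>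
        Def.eq (.pi fun c => Reindex.fst.eval (i, c)) (.pi fun c => Reindex.snd.eval (j, c))
      refine ((Def.all_finite fun i => Def.ex_finite fun j => h1 i j).and
        (Def.all_finite fun j => Def.ex_finite fun i => h1 i j)).congr fun p => ?_
      rw [Setoid.ker_def, Set.Subset.antisymm_iff, Set.range_subset_iff, Set.range_subset_iff]
      simp only [Set.mem_range]
      exact and_congr (forall_congr' fun i => exists_congr fun j => eq_comm) Iff.rfl)
  exact ⟨J, f, hf, fun a b => (h a b).symm.trans Setoid.ker_def⟩

/-! ### The absolute Galois group -/

theorem le_dcl (K : C.SSet) : K ≤ C.dcl K := by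
  intro j x hx
  refine ⟨.eq (j := j) (.var (s := withParams (fun _ : Unit => j) K) (.inl ()))
    (.var (s := withParams (fun _ : Unit => j) K) (.inr ⟨j, x, hx⟩)), ?_⟩
  rfl

/-- Automorphisms of `C` over `K` restrict to elements of `G(K)`. -/
theorem exists_absGal_of_autFix {g : ∀ j, Equiv.Perm (C.carrier j)} (hg : g ∈ C.autFix K) :
    ∃ σ : C.absGal K, ∀ j (x : C.acl K j), (σ.1 j x).1 = g j x.1 := by
  refine ⟨⟨fun j => (g j).subtypePerm fun x => autFix_mem_acl hg, ?_, ?_⟩, fun j x => rfl⟩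
  · intro α s φ x
    exact (C.sat_automorphism hg.1 φ fun a => (x a).1).symm
  · rintro j x ⟨φ, hφ⟩
    refine Subtype.ext ?_
    have : g j x.1 ∈ C.solutions K j φ := (autFix_solutions hg).2 (hφ ▸ rfl)
    rw [hφ] at this
    exact this

/-- On finite tuples, every element of `G(K)` agrees with an automorphism of `C` over `K`. -/
theorem IsMonster.exists_autFix (hC : C.IsMonster κ) (hK : #K.Elem < κ) (σ : C.absGal K)
    {γ : Type w} [Finite γ] {s : γ → ι} (x : ∀ c, C.acl K (s c)) :
    ∃ g ∈ C.autFix K, ∀ c, g _ (x c).1 = (σ.1 _ (x c)).1 :=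
  hC.exists_extension hK ((le_dcl K).trans (dcl_le_acl K)) σ.2.1
    (fun j y hy => congrArg Subtype.val (σ.2.2 j y (le_dcl K j hy))) x

/-- The pointwise stabilizer in `G(K)` of a tuple of algebraic elements. -/
def stab {γ : Type w} {s : γ → ι} (a : ∀ c, C.acl K (s c)) : Subgroup (C.absGal K) where
  carrier := {σ | ∀ c, σ.1 _ (a c) = a c}
  one_mem' := fun _ => rfl
  mul_mem' := by
    intro σ τ hσ hτ c
    have : (σ * τ).1 (s c) (a c) = σ.1 _ (τ.1 _ (a c)) := rfl
    rw [this, hτ c, hσ c]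
  inv_mem' := by
    intro σ hσ c
    exact (Equiv.symm_apply_eq (σ.1 (s c))).2 (hσ c).symm

theorem finite_orbit_tuple {γ : Type} [Finite γ] {s : γ → ι} (a : ∀ c, C.acl K (s c)) :
    ∃ O : Set (∀ c, C.carrier (s c)), O.Finite ∧
      ∀ g ∈ C.autFix K, (fun c => g _ (a c).1) ∈ O := by
  choose O hO h using fun c => exists_finite_orbit_of_mem_acl (a c).2
  exact ⟨Set.univ.pi O, Set.Finite.pi' hO |>.subset (by intro x hx; simpa using hx),
    fun g hg c _ => h c g hg⟩

/-- Every open subgroup of `G(K)` is the stabilizer of a finite tuple: if `H` contains the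
stabilizer of the finite tuple `e`, then `H` is the stabilizer of the code of the finite set of
conjugates of `e` under `H`. -/
theorem IsMonster.exists_stab_eq (hC : C.IsMonster κ) (hEI : C.UniformEI) (hK : #K.Elem < κ)
    {H : Subgroup (C.absGal K)}
    (hH : @IsOpen _ (C.autTopology (C.acl K) (C.dcl K)) (H : Set (C.absGal K))) :
    ∃ (J : List ι) (c : ∀ i : Fin J.length, C.acl K (J.get i)), stab c = H := by
  classical
  obtain ⟨n, s, e, he⟩ : ∃ (n : ℕ) (s : Fin n → ι) (e : ∀ c, C.acl K (s c)), stab e ≤ H := by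
    obtain ⟨U, hU, hUH⟩ := hH
    let : ∀ p : (C.acl K).Elem, TopologicalSpace (C.acl K p.1) := fun _ => ⊥
    have h1 : (fun p : (C.acl K).Elem => (1 : C.absGal K).1 p.1 p.2) ∈ U := by
      have : (1 : C.absGal K) ∈ (H : Set (C.absGal K)) := H.one_mem
      rwa [← hUH] at this
    obtain ⟨I, V, hV, hIV⟩ := isOpen_pi_iff.1 hU _ h1
    refine ⟨I.toList.length, fun i => (I.toList.get i).1, fun i => (I.toList.get i).2,
      fun σ hσ => ?_⟩
    have : σ ∈ (H : Set (C.absGal K)) := by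
      rw [← hUH]
      refine hIV fun p hp => ?_
      obtain ⟨i, hi⟩ := List.get_of_mem (Finset.mem_toList.2 hp)
      have h2 : σ.1 p.1 p.2 = p.2 := by
        subst hi
        exact hσ i
      change σ.1 p.1 p.2 ∈ V p
      rw [h2]
      exact (hV p hp).2
    exact this
  -- the set of conjugates of `e` under `H`
  obtain ⟨O, hO, hOe⟩ := finite_orbit_tuple e
  set T : Set (∀ c, C.carrier (s c)) := {x | ∃ σ ∈ H, x = fun c => (σ.1 _ (e c)).1} with hT
  have hTfin : T.Finite := by
    refine hO.subset ?_
    rintro _ ⟨σ, -, rfl⟩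
    obtain ⟨g, hg, hgσ⟩ := hC.exists_autFix hK σ e
    have := hOe g hg
    simp only [hgσ] at this
    exact this
  obtain ⟨N, y, hy⟩ : ∃ (N : ℕ) (y : Fin N → ∀ c, C.carrier (s c)), Set.range y = T := by
    have := hTfin.to_subtype
    obtain ⟨N, ⟨q⟩⟩ := Finite.exists_equiv_fin T
    exact ⟨N, fun i => (q.symm i).1, by rw [← Function.comp_def, q.symm.surjective.range_comp,
      Subtype.range_val]⟩
  obtain ⟨J, f, hf, hfr⟩ := hEI.exists_code_range s N
  have hyacl : ∀ p : Fin N × Fin n, y p.1 p.2 ∈ C.acl K (s p.2) := by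
    intro p
    have : y p.1 ∈ T := hy ▸ Set.mem_range_self _
    obtain ⟨σ, -, hσ⟩ := this
    rw [hσ]
    exact (σ.1 _ _).2
  let y' : ∀ p : Fin N × Fin n, C.acl K (s p.2) := fun p => ⟨y p.1 p.2, hyacl p⟩
  obtain ⟨O', hO', hOy⟩ := finite_orbit_tuple y'
  let d : C.Tup J := f fun p => (y' p).1
  have hd : ∀ i, d i ∈ C.acl K (J.get i) := by
    intro i
    refine hC.mem_acl_of_finite_orbit hK (hO'.image fun z => f z i) fun g hg => ?_
    refine ⟨_, hOy g hg, ?_⟩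
    exact congrFun (hf.equivariant hg.1 fun p => (y' p).1) i
  refine ⟨J, fun i => ⟨d i, hd i⟩, ?_⟩
  ext σ
  obtain ⟨g, hg, hgσ⟩ := hC.exists_autFix hK σ
    (s := Sum.elim (Sum.elim (fun p : Fin N × Fin n => s p.2) s) J.get)
    (fun c => match c with
      | .inl (.inl p) => y' p
      | .inl (.inr c) => e c
      | .inr i => ⟨d i, hd i⟩)
  have hgy : ∀ p, g _ (y p.1 p.2) = (σ.1 _ (y' p)).1 := fun p => hgσ (.inl (.inl p))
  have hge : ∀ c, g _ (e c).1 = (σ.1 _ (e c)).1 := fun c => hgσ (.inl (.inr c))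
  have hgd : ∀ i, g _ (d i) = (σ.1 _ ⟨d i, hd i⟩).1 := fun i => hgσ (.inr i)
  have h1 : σ ∈ stab (fun i => (⟨d i, hd i⟩ : C.acl K (J.get i))) ↔
      (Set.range fun i c => g _ (y i c)) = T := by
    rw [← hy]
    refine Iff.trans ?_ (hfr (fun p => g _ (y p.1 p.2)) fun p => y p.1 p.2)
    rw [show f (fun p => g _ (y p.1 p.2)) = fun i => g _ (d i) from
      hf.equivariant hg.1 fun p => (y' p).1]
    refine Iff.trans ?_ funext_iff.symm
    refine forall_congr' fun i => ?_
    rw [hgd, Subtype.ext_iff]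
  rw [h1]
  have h2 : ∀ τ ∈ H, ∃ i, (∀ c, g _ (y i c) = ((σ * τ).1 _ (e c)).1) := by
    intro τ hτ
    have : (fun c => (τ.1 _ (e c)).1) ∈ Set.range y := hy ▸ ⟨τ, hτ, rfl⟩
    obtain ⟨i, hi⟩ := this
    refine ⟨i, fun c => ?_⟩
    rw [hgy (i, c)]
    exact congrArg (fun z => (σ.1 (s c) z).1) (Subtype.ext (congrFun hi c))
  have h3 : ∀ i, ∃ τ ∈ H, ∀ c, g _ (y i c) = ((σ * τ).1 _ (e c)).1 := by
    intro i
    obtain ⟨τ, hτ, h⟩ : y i ∈ T := hy ▸ Set.mem_range_self i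
    refine ⟨τ, hτ, fun c => ?_⟩
    rw [hgy (i, c)]
    exact congrArg (fun z => (σ.1 (s c) z).1) (Subtype.ext (congrFun h c))
  constructor
  · intro h
    obtain ⟨i, hi⟩ := h2 1 H.one_mem
    have : (fun c => g _ (y i c)) ∈ T := h ▸ Set.mem_range_self i
    obtain ⟨τ, hτ, hτe⟩ := this
    have h4 : τ⁻¹ * σ ∈ H := he fun c => by
      have h5 : σ.1 _ (e c) = τ.1 _ (e c) := by
        refine Subtype.ext ?_
        have := congrFun hτe c
        simp only [hi c, mul_one] at this
        exact this
      exact (Equiv.symm_apply_eq (τ.1 (s c))).2 h5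
    simpa using H.mul_mem hτ h4
  · intro h
    ext x
    constructor
    · rintro ⟨i, rfl⟩
      obtain ⟨τ, hτ, h4⟩ := h3 i
      exact ⟨σ * τ, H.mul_mem h hτ, funext h4⟩
    · rintro ⟨τ, hτ, rfl⟩
      obtain ⟨i, hi⟩ := h2 (σ⁻¹ * τ) (H.mul_mem (H.inv_mem h) hτ)
      refine ⟨i, funext fun c => ?_⟩
      refine (hi c).trans ?_
      rw [mul_inv_cancel_left]

theorem le_fixedSet (H : Subgroup (C.absGal K)) : K ≤ C.fixedSet K H := fun j x hx =>
  ⟨dcl_le_acl K j (le_dcl K j hx), fun σ _ => σ.2.2 j ⟨x, _⟩ (le_dcl K j hx)⟩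

theorem mem_fixedSet_stab {γ : Type w} {s : γ → ι} (a : ∀ c, C.acl K (s c)) (c : γ) :
    (a c).1 ∈ C.fixedSet K (stab a) (s c) :=
  ⟨(a c).2, fun _ hσ => hσ c⟩

/-- The elements of `Aut(acl(K)^H/K)` are restrictions of elements of `G(K)`. -/
theorem IsMonster.exists_absGal_of_autGroup (hC : C.IsMonster κ) (hK : #K.Elem < κ)
    {γ : Type w} [Finite γ] {s : γ → ι} (a : ∀ c, C.acl K (s c))
    (σ : C.autGroup (C.fixedSet K (stab a)) K) :
    ∃ τ : C.absGal K, ∀ j (x : C.fixedSet K (stab a) j),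
      (τ.1 j ⟨x.1, x.2.1⟩).1 = (σ.1 j x).1 := by
  let a' : ∀ c, C.fixedSet K (stab a) (s c) := fun c => ⟨(a c).1, mem_fixedSet_stab a c⟩
  have hext := fun {γ : Type w} [Finite γ] {s : γ → ι} (x : ∀ c, C.fixedSet K (stab a) (s c)) =>
    hC.exists_extension hK (le_fixedSet (stab a)) σ.2.1
    (fun j y hy => congrArg Subtype.val (σ.2.2 j y hy)) x
  obtain ⟨g, hg, hga⟩ := hext a'
  obtain ⟨τ, hτ⟩ := exists_absGal_of_autFix hg
  refine ⟨τ, fun j x => ?_⟩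
  rw [hτ]
  -- an extension `g'` of `σ` that also respects `x` differs from `g` by an element of `stab a`
  obtain ⟨g', hg', hga'⟩ := hext (γ := Option γ) (s := extend s j) fun o => match o with
    | none => x
    | some c => a' c
  obtain ⟨ρ, hρ⟩ := exists_absGal_of_autFix (mul_mem (inv_mem hg) hg')
  have hρa : ρ ∈ stab a := fun c => by
    refine Subtype.ext ((hρ _ _).trans ?_)
    exact (Equiv.symm_apply_eq (g (s c))).2 ((hga' (some c)).trans (hga c).symm)
  have h1 : (ρ.1 j ⟨x.1, x.2.1⟩).1 = x.1 := congrArg Subtype.val (x.2.2 ρ hρa)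
  rw [hρ] at h1
  exact ((Equiv.symm_apply_eq (g j)).1 h1).symm.trans (hga' none)

/-- For the stabilizer `H` of a finite tuple, if `H` is normal and of finite index, then
`J ∈ F(H)` means that the tuples of sort `J` in `acl(K)^H` have common stabilizer `H`. -/
theorem IsMonster.mem_sorting_iff (hC : C.IsMonster κ) (hK : #K.Elem < κ)
    {γ : Type w} [Finite γ] {s : γ → ι} (a : ∀ c, C.acl K (s c)) (hn : (stab a).Normal)
    (hi : (stab a).index ≠ 0) (J : List ι) :
    J ∈ C.sorting K (stab a) ↔ ∀ τ : C.absGal K,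
      (∀ x : ∀ i : Fin J.length, C.fixedSet K (stab a) (J.get i),
        ∀ i, (τ.1 _ ⟨(x i).1, (x i).2.1⟩).1 = (x i).1) → τ ∈ stab a := by
  set H := stab a with hH
  let Γ := C.autGroup (C.fixedSet K H) K
  -- `Γ` is finite because it embeds into `G(K)/H`
  have hfin : Finite Γ := by
    have : H.FiniteIndex := ⟨hi⟩
    choose r hr using fun σ : Γ => hC.exists_absGal_of_autGroup hK a σ
    refine Finite.of_injective (fun σ => (r σ : C.absGal K ⧸ H)) fun σ σ' h => ?_
    have hρ := QuotientGroup.eq.1 h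
    refine Subtype.ext (funext fun j => Equiv.ext fun x => Subtype.ext ?_)
    rw [← hr, ← hr]
    have := x.2.2 _ hρ
    exact congrArg Subtype.val ((Equiv.symm_apply_eq ((r σ).1 j)).1 this).symm
  -- since `Γ` is finite, `J ∈ F(H)` if and only if the restriction map `F` is injective
  let F : Γ → C.autImage (C.fixedSet K H) K J := fun σ => ⟨tupPerm J σ.1, σ.1, σ.2, rfl⟩
  have hF : Function.Surjective F := by
    rintro ⟨_, σ, hσ, rfl⟩
    exact ⟨⟨σ, hσ⟩, rfl⟩
  have h1 : J ∈ C.sorting K H ↔ Function.Injective F := by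
    constructor
    · intro h
      obtain ⟨q⟩ := Cardinal.eq.1 h
      exact (Finite.injective_iff_surjective_of_equiv q.symm).2 hF
    · intro h
      exact Cardinal.eq.2 ⟨(Equiv.ofBijective F ⟨h, hF⟩).symm⟩
  rw [h1]
  constructor
  · intro h τ hτ
    -- the restriction of `τ` to `acl(K)^H`
    have hmem : ∀ (τ : C.absGal K) j (x : C.acl K j),
        x.1 ∈ C.fixedSet K H j → (τ.1 j x).1 ∈ C.fixedSet K H j := by
      intro τ j x hx
      refine ⟨(τ.1 j x).2, fun ρ hρ => ?_⟩
      have h2 : (τ⁻¹ * ρ * τ).1 j x = x := hx.2 _ (by simpa using hn.conj_mem ρ hρ τ⁻¹)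
      exact ((Equiv.symm_apply_eq (τ.1 j)).1 h2)
    let res : Γ := ⟨fun j =>
      { toFun := fun x => ⟨_, hmem τ j ⟨x.1, x.2.1⟩ x.2⟩
        invFun := fun x => ⟨_, hmem τ⁻¹ j ⟨x.1, x.2.1⟩ x.2⟩
        left_inv := fun x => by
          have h := congrArg Subtype.val ((τ.1 j).symm_apply_apply ⟨x.1, x.2.1⟩)
          exact Subtype.ext h
        right_inv := fun x => by
          have h := congrArg Subtype.val ((τ.1 j).apply_symm_apply ⟨x.1, x.2.1⟩)
          exact Subtype.ext h },
      fun α t φ x => τ.2.1 α t φ fun c => ⟨(x c).1, (x c).2.1⟩,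
      fun j x hx => by
        have h := congrArg Subtype.val (τ.2.2 j ⟨x.1, x.2.1⟩ (le_dcl K j hx))
        exact Subtype.ext h⟩
    have h2 : res = 1 := h (Subtype.ext (Equiv.ext fun x => funext fun i =>
      Subtype.ext (hτ x i)))
    intro c
    refine Subtype.ext ?_
    have h3 : res.1 (s c) ⟨_, mem_fixedSet_stab a c⟩ = ⟨_, mem_fixedSet_stab a c⟩ := by
      rw [h2]; rfl
    have h4 := congrArg Subtype.val h3
    exact h4
  · intro h
    have h2 : ∀ σ : Γ, tupPerm J σ.1 = 1 → σ = 1 := by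
      intro σ hσ
      obtain ⟨τ, hτ⟩ := hC.exists_absGal_of_autGroup hK a σ
      have hτH : τ ∈ H := h τ fun x i => by
        rw [hτ]
        exact congrArg Subtype.val (congrFun (Equiv.congr_fun hσ x) i)
      refine Subtype.ext (funext fun j => Equiv.ext fun x => Subtype.ext ?_)
      rw [← hτ]
      exact congrArg Subtype.val (x.2.2 τ hτH)
    intro σ σ' hσ
    have hσ' : tupPerm J σ.1 = tupPerm J σ'.1 := congrArg Subtype.val hσ
    have h3 : σ⁻¹ * σ' = 1 := h2 _ (Equiv.ext fun x => funext fun i => by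
      exact (Equiv.symm_apply_eq (σ.1 (J.get i))).2 (congrFun (Equiv.congr_fun hσ' x) i).symm)
    exact inv_mul_eq_one.1 h3

end Str
end SortedLanguage

namespace SortedLanguage
namespace Str

variable {ι : Type u} {L : SortedLanguage ι} {C : L.Str} {κ : Cardinal.{u}} {K : C.SSet}

/-! ### Definability of conjugacy in the pair -/

/-- Conjugacy of tuples over `K`. -/
def ConjOver (K : C.SSet) {γ : Type} {s : γ → ι} (x y : ∀ c, C.carrier (s c)) : Prop :=
  ∃ g ∈ C.autFix K, ∀ c, g _ (x c) = y c

/-- The tuple `x` has at most `N` conjugates over `K`. -/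
def OrbitLE (K : C.SSet) (N : ℕ) {γ : Type} {s : γ → ι} (x : ∀ c, C.carrier (s c)) : Prop :=
  ∃ w : Fin N → ∀ c, C.carrier (s c), ∀ g ∈ C.autFix K, ∃ i, w i = fun c => g _ (x c)

/-- Automorphisms over `K` that fix the tuple `x` also fix the tuple `y`. -/
def StabLE (K : C.SSet) {γ δ : Type} {s : γ → ι} {t : δ → ι} (x : ∀ c, C.carrier (s c))
    (y : ∀ d, C.carrier (t d)) : Prop :=
  ∀ g ∈ C.autFix K, (∀ c, g _ (x c) = x c) → ∀ d, g _ (y d) = y d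

variable {γ δ : Type} {s : γ → ι} {t : δ → ι}

theorem ConjOver.refl (x : ∀ c, C.carrier (s c)) : ConjOver K x x :=
  ⟨1, one_mem _, fun _ => rfl⟩

theorem ConjOver.orbitLE {N : ℕ} {x y : ∀ c, C.carrier (s c)} (h : ConjOver K x y)
    (hx : OrbitLE K N x) : OrbitLE K N y := by
  obtain ⟨g, hg, hgx⟩ := h
  obtain ⟨w, hw⟩ := hx
  refine ⟨w, fun g' hg' => ?_⟩
  obtain ⟨i, hi⟩ := hw _ (mul_mem hg' hg)
  refine ⟨i, hi.trans (funext fun c => ?_)⟩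
  rw [← hgx]
  rfl

theorem OrbitLE.sumVal {N N' : ℕ} {x : ∀ c, C.carrier (s c)} {y : ∀ d, C.carrier (t d)}
    (hx : OrbitLE K N x) (hy : OrbitLE K N' y) : OrbitLE K (N * N') (sumVal x y) := by
  obtain ⟨w, hw⟩ := hx
  obtain ⟨w', hw'⟩ := hy
  refine ⟨fun i => Str.sumVal (w (finProdFinEquiv.symm i).1) (w' (finProdFinEquiv.symm i).2),
    fun g hg => ?_⟩
  obtain ⟨i, hi⟩ := hw g hg
  obtain ⟨i', hi'⟩ := hw' g hg
  refine ⟨finProdFinEquiv (i, i'), ?_⟩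
  simp only [Equiv.symm_apply_apply, hi, hi']
  funext c
  rcases c with c | c <;> rfl

theorem IsMonster.mem_acl_of_orbitLE (hC : C.IsMonster κ) (hK : #K.Elem < κ) {N : ℕ}
    {x : ∀ c, C.carrier (s c)} (hx : OrbitLE K N x) (c : γ) : x c ∈ C.acl K (s c) := by
  obtain ⟨w, hw⟩ := hx
  refine hC.mem_acl_of_finite_orbit hK (Set.finite_range fun i => w i c) fun g hg => ?_
  obtain ⟨i, hi⟩ := hw g hg
  exact ⟨i, congrFun hi c⟩

/-- The hypotheses on a pair `(M, K)` in a monster model with uniform elimination of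
imaginaries. -/
structure IsPair (C : L.Str) (κ : Cardinal.{u}) (M : C.Substr) (K : C.SSet) : Prop where
  monster : C.IsMonster κ
  ei : C.UniformEI
  elementary : M.IsElementary
  small : #K.Elem < κ
  dcl_eq : C.dcl K = K
  le : K ≤ M.set

/-- The tuple of `C` underlying a tuple of the pair `(M, K)`. -/
def Substr.tup (M : C.Substr) (K : C.SSet) (x : ∀ c, (M.pair K).carrier (s c)) :
    ∀ c, C.carrier (s c) :=
  fun c => M.pt K (x c)

theorem Substr.tup_injective (M : C.Substr) (K : C.SSet) :
    Function.Injective (M.tup K (s := s)) := fun _ _ h =>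
  funext fun c => M.pt_injective K (congrFun h c)

theorem Substr.tup_sumVal (M : C.Substr) (K : C.SSet) (x : ∀ c, (M.pair K).carrier (s c))
    (y : ∀ d, (M.pair K).carrier (t d)) :
    M.tup K (sumVal x y) = sumVal (M.tup K x) (M.tup K y) := by
  funext c
  rcases c with c | c <;> rfl

namespace IsPair

variable {M : C.Substr}

theorem exists_tup (h : IsPair C κ M K) {x : ∀ c, C.carrier (s c)}
    (hx : ∀ c, x c ∈ C.acl K (s c)) : ∃ y, M.tup K y = x := by
  choose y hy using fun c =>
    M.exists_pt K (acl_le_of_isElementary h.elementary h.le _ (hx c))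
  exact ⟨y, funext hy⟩

/-- A tuple of `M` with a bound on its number of conjugates has all its conjugates in `M`. -/
theorem exists_tup_of_orbitLE (h : IsPair C κ M K) {N : ℕ} {x : ∀ c, C.carrier (s c)}
    (hx : OrbitLE K N x) {g : ∀ j, Equiv.Perm (C.carrier j)} (hg : g ∈ C.autFix K) :
    ∃ y, M.tup K y = fun c => g _ (x c) :=
  h.exists_tup (h.monster.mem_acl_of_orbitLE h.small
    (ConjOver.orbitLE ⟨g, hg, fun _ => rfl⟩ hx))

/-- A function definable in `C` has a graph definable in the pair. -/
theorem def_graph [Finite γ] [Finite δ] (h : IsPair C κ M K)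
    {f : (∀ c, C.carrier (s c)) → ∀ d, C.carrier (t d)}
    (hf : C.Definable (Sum.elim s t)
      {z | f (fun i => z (Sum.inl i)) = fun i => z (Sum.inr i)}) :
    (M.pair K).Def fun p : (∀ c, (M.pair K).carrier (s c)) × (∀ d, (M.pair K).carrier (t d)) =>
      f (M.tup K p.1) = M.tup K p.2 := by
  refine Def.of_definable (Ω := (∀ c, (M.pair K).carrier (s c)) × (∀ d, (M.pair K).carrier (t d)))
    (hf.toPair h.elementary K) (fun p => sumVal p.1 p.2)
    (Sum.map (fun c => ⟨c, ()⟩) fun c => ⟨c, ()⟩) ?_ ?_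
  · rintro (c | c) <;> rfl
  · rintro p (c | c) <;> rfl

/-- The code of a finite set of tuples lies in `K` if and only if the set is invariant under
the automorphisms over `K`. -/
theorem code_mem_iff (h : IsPair C κ M K) {N : ℕ} {J : List ι}
    {f : (∀ p : Fin N × γ, C.carrier (s p.2)) → C.Tup J}
    (hf : C.Definable (Sum.elim (fun p : Fin N × γ => s p.2) J.get)
        {z | f (fun i => z (Sum.inl i)) = fun i => z (Sum.inr i)})
    (hfr : ∀ a b, f a = f b ↔ (Set.range fun i c => a (i, c) : Set (∀ c, C.carrier (s c))) =
      Set.range fun i c => b (i, c)) (y : ∀ p : Fin N × γ, C.carrier (s p.2)) :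
    (∀ i, f y i ∈ K (J.get i)) ↔ ∀ g ∈ C.autFix K,
      (Set.range fun i c => g _ (y (i, c)) : Set (∀ c, C.carrier (s c))) =
        Set.range fun i c => y (i, c) := by
  have h1 : ∀ g ∈ C.autFix K, (f (fun p => g _ (y p)) = f y ↔
      (Set.range fun i c => g _ (y (i, c)) : Set (∀ c, C.carrier (s c))) =
        Set.range fun i c => y (i, c)) := fun g _ => hfr _ _
  constructor
  · intro hy g hg
    rw [← h1 g hg, hf.equivariant hg.1]
    exact funext fun i => hg.2 _ _ (hy i)
  · intro hy i
    rw [← h.dcl_eq]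
    refine h.monster.mem_dcl_of_fixed h.small fun g hg => ?_
    have := (h1 g hg).2 (hy g hg)
    rw [hf.equivariant hg.1] at this
    exact congrFun this i

/-- Conjugacy over `K` is definable in the pair, uniformly on the tuples with at most `N`
conjugates: the set of conjugates of such a tuple is the smallest set of at most `N` tuples that
contains it and has its code in `K`. -/
theorem def_conjOver [Finite γ] (h : IsPair C κ M K) (s : γ → ι) (N : ℕ) :
    (M.pair K).Def fun p : (∀ c, (M.pair K).carrier (s c)) × (∀ c, (M.pair K).carrier (s c)) =>
      OrbitLE K N (M.tup K p.1) ∧ ConjOver K (M.tup K p.1) (M.tup K p.2) := by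
  classical
  obtain ⟨J, f, hf, hfr⟩ := h.ei.exists_code_range s N
  let Y := ∀ p : Fin N × γ, (M.pair K).carrier (s p.2)
  let inv : Y → Prop := fun y => ∀ i, f (M.tup K y) i ∈ K (J.get i)
  have hinv : (M.pair K).Def inv := by
    refine (Def.ex (P := fun (y : Y) (z : ∀ i, (M.pair K).carrier (J.get i)) =>
      f (M.tup K y) = M.tup K z ∧ ∀ i, M.pt K (z i) ∈ K (J.get i)) ((h.def_graph hf).and
      (Def.all_finite fun i => (def_mem_pred M K (J.get i)).comp
        (Reindex.snd.eval i)))).congr fun y => ?_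
    constructor
    · intro hy
      choose z hz using fun i => M.exists_pt K (h.le _ (hy i))
      exact ⟨z, (funext hz).symm, fun i => (hz i).symm ▸ hy i⟩
    · rintro ⟨z, hz, hzK⟩ i
      exact hz ▸ hzK i
  let Q : (∀ c, (M.pair K).carrier (s c)) → Y → Prop := fun x y =>
    inv y ∧ ∃ i, x = fun c => y (i, c)
  have hQ : (M.pair K).Def fun p : (∀ c, (M.pair K).carrier (s c)) × Y => Q p.1 p.2 :=
    (hinv.comp Reindex.snd).and
      (Def.ex_finite fun i => Def.eq Reindex.fst (.pi fun c => Reindex.snd.eval (i, c)))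
  have hQ' : ∀ x y, Q x y → ∀ x', ConjOver K (M.tup K x) (M.tup K x') → Q x' y := by
    rintro _ y ⟨hy, i, rfl⟩ x' ⟨g, hg, hgx⟩
    refine ⟨hy, ?_⟩
    have h1 := (h.code_mem_iff hf hfr _).1 hy g hg
    have h2 : M.tup K x' ∈ (Set.range fun i c => M.tup K y (i, c) :
        Set (∀ c, C.carrier (s c))) := by
      rw [← h1]
      exact ⟨i, funext hgx⟩
    obtain ⟨i', hi'⟩ := h2
    exact ⟨i', M.tup_injective K hi'.symm⟩
  -- the set of all conjugates is the set of rows of some `y`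
  have hex : ∀ x, OrbitLE K N (M.tup K x) →
      ∃ y, Q x y ∧ ∀ x', Q x' y → ConjOver K (M.tup K x) (M.tup K x') := by
    intro x hx
    obtain ⟨w, hw⟩ := hx
    -- entries of `w` that are not conjugates of `x` are replaced by `x` itself
    let w' : Fin N → ∀ c, C.carrier (s c) := fun i =>
      if ConjOver K (M.tup K x) (w i) then w i else M.tup K x
    have hw' : ∀ i, ConjOver K (M.tup K x) (w' i) := by
      intro i
      by_cases hi : ConjOver K (M.tup K x) (w i)
      · simpa only [w', if_pos hi] using hi
      · simpa only [w', if_neg hi] using ConjOver.refl _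
    have hw'' : ∀ g ∈ C.autFix K, ∃ i, w' i = fun c => g _ (M.tup K x c) := by
      intro g hg
      obtain ⟨i, hi⟩ := hw g hg
      refine ⟨i, ?_⟩
      have : ConjOver K (M.tup K x) (w i) := ⟨g, hg, fun c => (congrFun hi c).symm⟩
      simpa only [w', if_pos this] using hi
    obtain ⟨y, hy⟩ := h.exists_tup (x := fun p : Fin N × γ => w' p.1 p.2) fun p =>
      h.monster.mem_acl_of_orbitLE h.small ((hw' p.1).orbitLE ⟨w, hw⟩) p.2
    refine ⟨y, ⟨?_, ?_⟩, ?_⟩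
    · refine (h.code_mem_iff hf hfr _).2 fun g hg => ?_
      rw [hy]
      ext z
      constructor
      · rintro ⟨i, rfl⟩
        obtain ⟨g', hg', hgi⟩ := hw' i
        obtain ⟨i', hi'⟩ := hw'' _ (mul_mem hg hg')
        refine ⟨i', hi'.trans (funext fun c => ?_)⟩
        exact congrArg (g (s c)) (hgi c)
      · rintro ⟨i, rfl⟩
        obtain ⟨g', hg', hgi⟩ := hw' i
        obtain ⟨i', hi'⟩ := hw'' _ (mul_mem (inv_mem hg) hg')
        refine ⟨i', funext fun c => ?_⟩
        have h1 : w' i' c = g⁻¹ (s c) (g' (s c) (M.tup K x c)) := congrFun hi' c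
        change g (s c) (w' i' c) = w' i c
        rw [h1, hgi]
        exact (g (s c)).apply_symm_apply _
    · obtain ⟨i, hi⟩ := hw'' 1 (one_mem _)
      refine ⟨i, M.tup_injective K ?_⟩
      exact hi.symm.trans (funext fun c => (congrFun hy (i, c)).symm)
    · rintro _ ⟨-, i, rfl⟩
      have : M.tup K (fun c => y (i, c)) = w' i := funext fun c => congrFun hy (i, c)
      exact this ▸ hw' i
  refine (((Def.ex (P := Q) hQ).comp Reindex.fst).and
    (Def.all (P := fun (p : (∀ c, (M.pair K).carrier (s c)) × (∀ c, (M.pair K).carrier (s c)))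
      (y : Y) => Q p.1 y → Q p.2 y) ((hQ.comp (Reindex.fst.fst'.pair Reindex.snd)).imp
        (hQ.comp (Reindex.fst.snd'.pair Reindex.snd))))).congr fun p => ?_
  obtain ⟨x, x'⟩ := p
  constructor
  · rintro ⟨hx, hxx'⟩
    obtain ⟨y, hy, -⟩ := hex x hx
    exact ⟨⟨y, hy⟩, fun y hy => hQ' x y hy x' hxx'⟩
  · rintro ⟨⟨y, hy⟩, hall⟩
    have hx : OrbitLE K N (M.tup K x) := by
      refine ⟨fun i c => M.tup K y (i, c), fun g hg => ?_⟩
      have h1 := (h.code_mem_iff hf hfr _).1 hy.1 g hg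
      obtain ⟨i, rfl⟩ := hy.2
      have h2 : (fun c => g _ (M.tup K y (i, c))) ∈ (Set.range fun i c => M.tup K y (i, c) :
          Set (∀ c, C.carrier (s c))) := by
        rw [← h1]
        exact ⟨i, rfl⟩
      exact h2
    obtain ⟨y', hy', h'⟩ := hex x hx
    exact ⟨hx, h' x' (hall y' hy')⟩

theorem def_orbitLE [Finite γ] (h : IsPair C κ M K) (s : γ → ι) (N : ℕ) :
    (M.pair K).Def fun x : ∀ c, (M.pair K).carrier (s c) => OrbitLE K N (M.tup K x) :=
  ((h.def_conjOver s N).comp (Reindex.id.pair Reindex.id)).congr fun _ =>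
    (and_iff_left (ConjOver.refl _)).symm

/-- Simultaneous conjugacy of two tuples. -/
theorem def_conjOver_pair [Finite γ] [Finite δ] (h : IsPair C κ M K) (s : γ → ι)
    (t : δ → ι) (N N' : ℕ) :
    (M.pair K).Def fun p :
      ((∀ c, (M.pair K).carrier (s c)) × (∀ d, (M.pair K).carrier (t d))) ×
        ((∀ c, (M.pair K).carrier (s c)) × (∀ d, (M.pair K).carrier (t d))) =>
      OrbitLE K N (M.tup K p.1.1) ∧ OrbitLE K N' (M.tup K p.1.2) ∧
        ∃ g ∈ C.autFix K, (∀ c, g _ (M.tup K p.1.1 c) = M.tup K p.2.1 c) ∧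
          ∀ d, g _ (M.tup K p.1.2 d) = M.tup K p.2.2 d := by
  have hsum : (M.pair K).Reindex fun p :
      (∀ c, (M.pair K).carrier (s c)) × (∀ d, (M.pair K).carrier (t d)) => sumVal p.1 p.2 := by
    refine ⟨fun p => match p with
      | ⟨.inl c, _⟩ => .inl ⟨c, ()⟩
      | ⟨.inr d, _⟩ => .inr ⟨d, ()⟩, ?_, ?_⟩
    · rintro ⟨c | c, _⟩ <;> rfl
    · rintro p ⟨c | c, _⟩ <;> rfl
  refine (((h.def_orbitLE s N).comp Reindex.fst.fst').and
    (((h.def_orbitLE t N').comp Reindex.fst.snd').and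
    ((h.def_conjOver (Sum.elim s t) (N * N')).comp
      ((hsum.comp Reindex.fst).pair (hsum.comp Reindex.snd))))).congr fun p => ?_
  refine and_congr_right fun h1 => and_congr_right fun h2 => ?_
  simp only [Substr.tup_sumVal]
  refine Iff.trans ?_ (and_iff_right (h1.sumVal h2)).symm
  refine exists_congr fun g => and_congr_right fun _ => ?_
  rw [Sum.forall]
  exact Iff.rfl

/-- Inclusion of stabilizers: `y` is fixed by the stabilizer of `x` if and only if `(x, y)` has no
conjugate `(x, y')` with `y' ≠ y`. -/
theorem def_stabLE [Finite γ] [Finite δ] (h : IsPair C κ M K) (s : γ → ι) (t : δ → ι) (N N' : ℕ) :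
    (M.pair K).Def fun p :
      (∀ c, (M.pair K).carrier (s c)) × (∀ d, (M.pair K).carrier (t d)) =>
      OrbitLE K N (M.tup K p.1) ∧ OrbitLE K N' (M.tup K p.2) ∧
        StabLE K (M.tup K p.1) (M.tup K p.2) := by
  have h1 := (h.def_conjOver_pair s t N N').comp
    (f := fun p : ((∀ c, (M.pair K).carrier (s c)) × (∀ d, (M.pair K).carrier (t d))) ×
      (∀ d, (M.pair K).carrier (t d)) => ((p.1.1, p.1.2), (p.1.1, p.2)))
    (Reindex.fst.pair (Reindex.fst.fst'.pair Reindex.snd))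
  refine (((h.def_orbitLE s N).comp Reindex.fst).and (((h.def_orbitLE t N').comp
    Reindex.snd).and (Def.all (P := fun (p : (∀ c, (M.pair K).carrier (s c)) ×
      (∀ d, (M.pair K).carrier (t d))) (y : ∀ d, (M.pair K).carrier (t d)) =>
      (OrbitLE K N (M.tup K p.1) ∧ OrbitLE K N' (M.tup K p.2) ∧
        ∃ g ∈ C.autFix K, (∀ c, g _ (M.tup K p.1 c) = M.tup K p.1 c) ∧
          ∀ d, g _ (M.tup K p.2 d) = M.tup K y d) → y = p.2)
        (h1.imp (Def.eq Reindex.snd Reindex.fst.snd'))))).congr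
    fun p => and_congr_right fun hx => and_congr_right fun hy => ?_
  constructor
  · rintro hst y' ⟨-, -, g, hg, hgx, hgy⟩
    exact M.tup_injective K (funext fun d => (hgy d).symm.trans (hst g hg hgx d))
  · intro hall g hg hgx d
    obtain ⟨y', hy'⟩ := h.exists_tup_of_orbitLE hy hg
    have h2 := hall y' ⟨hx, hy, g, hg, hgx, fun d => (congrFun hy' d).symm⟩
    subst h2
    exact (congrFun hy' d).symm

/-- Normality of the stabilizer of `x`: it is contained in the stabilizers of all conjugates of
`x`. -/
theorem def_normal [Finite γ] (h : IsPair C κ M K) (s : γ → ι) (N : ℕ) :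
    (M.pair K).Def fun x : ∀ c, (M.pair K).carrier (s c) =>
      OrbitLE K N (M.tup K x) ∧
        ∀ g ∈ C.autFix K, StabLE K (M.tup K x) (fun c => g _ (M.tup K x c)) := by
  refine ((h.def_orbitLE s N).and (Def.all (P := fun x x' =>
    OrbitLE K N (M.tup K x) ∧ ConjOver K (M.tup K x) (M.tup K x') →
    OrbitLE K N (M.tup K x) ∧ OrbitLE K N (M.tup K x') ∧ StabLE K (M.tup K x) (M.tup K x'))
    ((h.def_conjOver s N).imp (h.def_stabLE s s N N)))).congr
    fun x => and_congr_right fun hx => ?_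
  constructor
  · rintro hst x' ⟨-, hxx'⟩
    refine ⟨hx, hxx'.orbitLE hx, ?_⟩
    obtain ⟨g, hg, hgx⟩ := hxx'
    rw [← show (fun c => g _ (M.tup K x c)) = M.tup K x' from funext hgx]
    exact hst g hg
  · intro hall g hg
    obtain ⟨x', hx'⟩ := h.exists_tup_of_orbitLE hx hg
    have := (hall x' ⟨hx, g, hg, fun c => (congrFun hx' c).symm⟩).2.2
    rwa [hx'] at this

end IsPair
end Str
end SortedLanguage

namespace SortedLanguage
namespace Str

variable {ι : Type u} {L : SortedLanguage ι} {C : L.Str} {κ : Cardinal.{u}} {K : C.SSet}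
variable {M : C.Substr} {γ δ : Type} {s : γ → ι} {t : δ → ι}

/-! ### Stabilizers of finite tuples -/

theorem isOpen_stab [Finite γ] (a : ∀ c, C.acl K (s c)) :
    @IsOpen _ (C.autTopology (C.acl K) (C.dcl K)) (stab a : Set (C.absGal K)) := by
  let : ∀ p : (C.acl K).Elem, TopologicalSpace (C.acl K p.1) := fun _ => ⊥
  have : ∀ p : (C.acl K).Elem, DiscreteTopology (C.acl K p.1) := fun _ => ⟨rfl⟩
  refine ⟨⋂ c, (fun f : ∀ p : (C.acl K).Elem, C.acl K p.1 => f ⟨s c, a c⟩) ⁻¹' {a c}, ?_, ?_⟩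
  · exact isOpen_iInter_of_finite fun c =>
      (isOpen_discrete _).preimage (continuous_apply (⟨s c, a c⟩ : (C.acl K).Elem))
  · ext σ
    simp only [Set.mem_preimage, Set.mem_iInter, Set.mem_singleton_iff]
    rfl

theorem exists_surjective_of_card_le {X : Type*} [Finite X] [Nonempty X] {k : ℕ}
    (h : Nat.card X ≤ k) : ∃ q : Fin k → X, Function.Surjective q := by
  let e : X ↪ Fin k := (Finite.equivFin X).toEmbedding.trans (Fin.castLEEmb h)
  exact ⟨Function.invFun e, Function.invFun_surjective e.injective⟩

theorem IsMonster.conjOver_iff [Finite γ] (hC : C.IsMonster κ) (hK : #K.Elem < κ)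
    (a b : ∀ c, C.acl K (s c)) :
    ConjOver K (fun c => (a c).1) (fun c => (b c).1) ↔
      ∃ σ : C.absGal K, ∀ c, σ.1 _ (a c) = b c := by
  constructor
  · rintro ⟨g, hg, hga⟩
    obtain ⟨σ, hσ⟩ := exists_absGal_of_autFix hg
    exact ⟨σ, fun c => Subtype.ext ((hσ _ _).trans (hga c))⟩
  · rintro ⟨σ, hσ⟩
    obtain ⟨g, hg, hga⟩ := hC.exists_autFix hK σ a
    exact ⟨g, hg, fun c => (hga c).trans (congrArg Subtype.val (hσ c))⟩

theorem IsMonster.conjOver_pair_iff [Finite γ] [Finite δ] (hC : C.IsMonster κ)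
    (hK : #K.Elem < κ) (a a' : ∀ c, C.acl K (s c)) (b b' : ∀ d, C.acl K (t d)) :
    (∃ g ∈ C.autFix K, (∀ c, g _ (a c).1 = (a' c).1) ∧ ∀ d, g _ (b d).1 = (b' d).1) ↔
      ∃ σ : C.absGal K, (∀ c, σ.1 _ (a c) = a' c) ∧ ∀ d, σ.1 _ (b d) = b' d := by
  constructor
  · rintro ⟨g, hg, hga, hgb⟩
    obtain ⟨σ, hσ⟩ := exists_absGal_of_autFix hg
    exact ⟨σ, fun c => Subtype.ext ((hσ _ _).trans (hga c)),
      fun d => Subtype.ext ((hσ _ _).trans (hgb d))⟩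
  · rintro ⟨σ, hσa, hσb⟩
    obtain ⟨g, hg, hgab⟩ := hC.exists_autFix hK σ (s := Sum.elim s t) (fun c => match c with
      | .inl c => a c
      | .inr d => b d)
    exact ⟨g, hg, fun c => (hgab (.inl c)).trans (congrArg Subtype.val (hσa c)),
      fun d => (hgab (.inr d)).trans (congrArg Subtype.val (hσb d))⟩

theorem IsMonster.stabLE_iff [Finite γ] [Finite δ] (hC : C.IsMonster κ) (hK : #K.Elem < κ)
    (a : ∀ c, C.acl K (s c)) (b : ∀ d, C.acl K (t d)) :
    StabLE K (fun c => (a c).1) (fun d => (b d).1) ↔ stab a ≤ stab b := by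
  constructor
  · intro h σ hσ d
    obtain ⟨g, hg, hgab⟩ := hC.exists_autFix hK σ (s := Sum.elim s t) (fun c => match c with
      | .inl c => a c
      | .inr d => b d)
    have h1 := h g hg (fun c => (hgab (.inl c)).trans (congrArg Subtype.val (hσ c))) d
    exact Subtype.ext ((hgab (.inr d)).symm.trans h1)
  · intro h g hg hga d
    obtain ⟨σ, hσ⟩ := exists_absGal_of_autFix hg
    have h1 : σ ∈ stab b := h fun c => Subtype.ext ((hσ _ _).trans (hga c))
    exact (hσ _ _).symm.trans (congrArg Subtype.val (h1 d))

theorem quotient_mk_eq_iff (a : ∀ c, C.acl K (s c)) (σ τ : C.absGal K) :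
    (σ : C.absGal K ⧸ stab a) = τ ↔ ∀ c, σ.1 _ (a c) = τ.1 _ (a c) := by
  rw [QuotientGroup.eq]
  refine forall_congr' fun c => ?_
  refine (Equiv.symm_apply_eq (σ.1 (s c))).trans eq_comm

/-- The number of conjugates of a finite tuple is the index of its stabilizer. -/
theorem IsMonster.orbitLE_iff [Finite γ] (hC : C.IsMonster κ) (hK : #K.Elem < κ)
    (a : ∀ c, C.acl K (s c)) (k : ℕ) :
    OrbitLE K k (fun c => (a c).1) ↔ (stab a).index ≠ 0 ∧ (stab a).index ≤ k := by
  constructor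
  · rintro ⟨w, hw⟩
    have h1 : ∀ q : C.absGal K ⧸ stab a, ∃ i, w i = fun c => (q.out.1 _ (a c)).1 := by
      intro q
      obtain ⟨g, hg, hga⟩ := hC.exists_autFix hK q.out a
      obtain ⟨i, hi⟩ := hw g hg
      exact ⟨i, hi.trans (funext hga)⟩
    choose i hi using h1
    have hinj : Function.Injective i := by
      intro q q' hq
      rw [← q.out_eq', ← q'.out_eq']
      refine (quotient_mk_eq_iff a _ _).2 fun c => Subtype.ext ?_
      have := (hi q).symm.trans ((congrArg w hq).trans (hi q'))
      exact congrFun this c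
    have := Finite.of_injective i hinj
    refine ⟨Nat.card_pos.ne', ?_⟩
    simpa [Subgroup.index] using Nat.card_le_card_of_injective i hinj
  · rintro ⟨h0, hk⟩
    have : (stab a).FiniteIndex := ⟨h0⟩
    obtain ⟨q, hq⟩ := exists_surjective_of_card_le (X := C.absGal K ⧸ stab a) hk
    refine ⟨fun n c => ((q n).out.1 _ (a c)).1, fun g hg => ?_⟩
    obtain ⟨σ, hσ⟩ := exists_absGal_of_autFix hg
    obtain ⟨n, hn⟩ := hq σ
    refine ⟨n, funext fun c => ?_⟩
    rw [← hσ]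
    refine congrArg Subtype.val ((quotient_mk_eq_iff a _ _).1 ?_ c)
    rw [← hn]
    exact (q n).out_eq'

/-- Predicates definable in `C` restrict to definable predicates on tuples of the pair. -/
theorem IsPair.def_tup (h : IsPair C κ M K) [Finite γ] {W : (∀ c, C.carrier (s c)) → Prop}
    (hW : C.Def W) : (M.pair K).Def fun x : ∀ c, (M.pair K).carrier (s c) => W (M.tup K x) := by
  have h1 : C.Definable s {x | W x} :=
    Definable.of_def hW (fun x => x) (fun p => p.1) (fun _ => rfl) fun _ _ => HEq.rfl
  exact Def.of_definable (Ω := ∀ c, (M.pair K).carrier (s c)) (h1.toPair h.elementary K)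
    (fun x => x) (fun c => ⟨c, ()⟩) (fun _ => rfl) fun _ _ => HEq.rfl

/-! ### Tuples that code the subgroups in a sort of the system -/

/-- The tuples of sort `J` together with one point "at infinity" form a definable set `W` in
another product of sorts, as far as stabilizers are concerned. The additional point takes care
of the full group `G(K)`, which need not be the stabilizer of a tuple of sort `J`. -/
theorem IsPair.exists_pointed (h : IsPair C κ M K) (J : List ι) :
    ∃ (J' : List ι) (W : C.Tup J' → Prop), C.Def W ∧
      (∀ x : ∀ i : Fin J.length, C.acl K (J.get i),
        ∃ d : ∀ i : Fin J'.length, C.acl K (J'.get i),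
          W (fun i => (d i).1) ∧ stab d = stab x) ∧
      (∃ d : ∀ i : Fin J'.length, C.acl K (J'.get i), W (fun i => (d i).1) ∧ stab d = ⊤) ∧
      ∀ d : ∀ i : Fin J'.length, C.acl K (J'.get i), W (fun i => (d i).1) →
        stab d = ⊤ ∨ ∃ x : ∀ i : Fin J.length, C.acl K (J.get i), stab d = stab x := by
  classical
  by_cases hJ : Subsingleton (C.Tup J)
  · -- all tuples of sort `J` have stabilizer `G(K)`, and so has the empty tuple
    have htop : ∀ d : ∀ i : Fin ([] : List ι).length, C.acl K (([] : List ι).get i),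
        stab d = ⊤ := fun d => eq_top_iff.2 fun σ _ i => i.elim0
    refine ⟨[], fun _ => True, Def.true, fun x => ⟨fun i => i.elim0, trivial, ?_⟩,
      ⟨fun i => i.elim0, trivial, htop _⟩, fun d _ => Or.inl (htop d)⟩
    rw [htop, eq_comm, eq_top_iff]
    intro σ _ i
    exact Subtype.ext (congrFun (hJ.elim (fun i => (σ.1 _ (x i)).1) fun i => (x i).1) i)
  obtain ⟨u₀, v₀, huv⟩ : ∃ u v : C.Tup J, u ≠ v := by
    by_contra! hcon
    exact hJ ⟨hcon⟩
  -- a pair `(u, v)` stands for `u` if `u = v`, and for infinity otherwise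
  let X := ∀ p : Bool × Fin J.length, C.carrier (J.get p.2)
  let key : X → Option (C.Tup J) := fun x =>
    if (fun i => x (true, i)) = (fun i => x (false, i)) then some fun i => x (true, i) else none
  have hrow : ∀ b : Bool, C.Reindex fun (x : X) (i : Fin J.length) => x (b, i) := fun b =>
    .pi fun i => Reindex.id.eval (b, i)
  have hdiag : C.Def fun x : X => (fun i => x (true, i)) = (fun i => x (false, i)) :=
    Def.eq (hrow true) (hrow false)
  obtain ⟨J', f, hf, hfr⟩ := h.ei.exists_code (s := fun p : Bool × Fin J.length => J.get p.2)
    (Setoid.ker key) (by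
      refine (((hdiag.comp Reindex.fst).and ((hdiag.comp Reindex.snd).and
        (Def.eq ((hrow true).comp Reindex.fst) ((hrow true).comp Reindex.snd)))).or
        ((hdiag.comp Reindex.fst).not.and (hdiag.comp Reindex.snd).not)).congr fun p => ?_
      rw [Setoid.ker_def]
      simp only [key]
      split_ifs with h1 h2 h2 <;> simp [h1, h2])
  have hker : ∀ x y : X, f x = f y ↔ key x = key y := fun x y =>
    (hfr x y).symm.trans Setoid.ker_def
  let diag : C.Tup J → X := fun u p => u p.2
  have hkd : ∀ u, key (diag u) = some u := fun u => if_pos rfl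
  let inf : X := fun p => if p.1 then u₀ p.2 else v₀ p.2
  have hki : ∀ g : ∀ j, Equiv.Perm (C.carrier j), key (fun p => g _ (inf p)) = none := by
    intro g
    refine if_neg fun h1 => huv (funext fun i => (g _).injective ?_)
    exact congrFun h1 i
  have hfix : ∀ g ∈ C.autFix K, ∀ x : X, key x = none → (fun i => g _ (f x i)) = f x := by
    intro g hg x hx
    have h1 : f x = f inf := (hker _ _).2 (hx.trans (hki 1).symm)
    rw [h1, ← hf.equivariant hg.1 inf]
    exact (hker _ _).2 ((hki g).trans (hki 1).symm)
  have hinj : Function.Injective fun u => f (diag u) := fun u u' huu' =>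
    Option.some_injective _ ((hkd u).symm.trans (((hker _ _).1 huu').trans (hkd u')))
  have hequi : ∀ g ∈ C.autFix K, ∀ u : C.Tup J,
      (fun i => g _ (f (diag u) i)) = f (diag fun i => g _ (u i)) := fun g hg u =>
    (hf.equivariant hg.1 (diag u)).symm
  have hstab : ∀ (d : ∀ i : Fin J'.length, C.acl K (J'.get i))
      (x : ∀ i : Fin J.length, C.acl K (J.get i)),
      f (diag fun i => (x i).1) = (fun i => (d i).1) → stab d = stab x := by
    intro d x hdx
    refine le_antisymm ((h.monster.stabLE_iff h.small d x).1 fun g hg hgd => ?_)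
      ((h.monster.stabLE_iff h.small x d).1 fun g hg hgx => ?_)
    · have h1 := hequi g hg fun i => (x i).1
      rw [hdx, show (fun i => g _ (d i).1) = fun i => (d i).1 from funext hgd, ← hdx] at h1
      have h2 : (fun i => (x i).1) = fun i => g _ (x i).1 := hinj h1
      exact fun i => (congrFun h2 i).symm
    · have h1 := hequi g hg fun i => (x i).1
      rw [show (fun i => g _ (x i).1) = fun i => (x i).1 from funext hgx, hdx] at h1
      exact congrFun h1
  have hstab' : ∀ (d : ∀ i : Fin J'.length, C.acl K (J'.get i)) (x : X),
      key x = none → f x = (fun i => (d i).1) → stab d = ⊤ := by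
    intro d x hx hdx
    refine eq_top_iff.2 fun σ _ i => ?_
    obtain ⟨g, hg, hgd⟩ := h.monster.exists_autFix h.small σ d
    have h1 := hfix g hg x hx
    rw [hdx] at h1
    exact Subtype.ext ((hgd i).symm.trans (congrFun h1 i))
  refine ⟨J', fun d => ∃ x, f x = d, ?_, fun x => ?_, ?_, ?_⟩
  · refine Def.ex (P := fun d x => f x = d) ?_
    refine Def.of_definable (Ω := C.Tup J' × X) hf (fun p => sumVal p.2 p.1)
      (Sum.elim (fun c => .inr ⟨c, ()⟩) fun c => .inl ⟨c, ()⟩) ?_ ?_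
    · rintro (c | c) <;> rfl
    · rintro p (c | c) <;> rfl
  · obtain ⟨O, hO, hOx⟩ := finite_orbit_tuple x
    have hd : ∀ i, f (diag fun i => (x i).1) i ∈ C.acl K (J'.get i) := fun i => by
      refine h.monster.mem_acl_of_finite_orbit h.small (hO.image fun u => f (diag u) i)
        fun g hg => ?_
      exact ⟨_, hOx g hg, (congrFun (hequi g hg fun i => (x i).1) i).symm⟩
    exact ⟨fun i => ⟨_, hd i⟩, ⟨_, rfl⟩, hstab _ x rfl⟩
  · have hd : ∀ i, f inf i ∈ C.acl K (J'.get i) := fun i =>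
      h.monster.mem_acl_of_finite_orbit h.small (Set.finite_singleton (f inf i))
        fun g hg => congrFun (hfix g hg inf (hki 1)) i
    exact ⟨fun i => ⟨_, hd i⟩, ⟨_, rfl⟩, hstab' _ inf (hki 1) rfl⟩
  · rintro d ⟨x, hx⟩
    rcases hkx : key x with _ | u
    · exact Or.inl (hstab' d x hkx hx)
    · right
      have h1 : f (diag u) = fun i => (d i).1 := by
        rw [← hx]
        exact (hker _ _).2 ((hkd u).trans hkx.symm)
      obtain ⟨O, hO, hOd⟩ := finite_orbit_tuple d
      have hu : ∀ i, u i ∈ C.acl K (J.get i) := fun i => by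
        refine h.monster.mem_acl_of_finite_orbit h.small
          ((hO.preimage hinj.injOn).image fun u => u i) fun g hg => ?_
        refine ⟨fun i => g _ (u i), ?_, rfl⟩
        have h2 := hOd g hg
        change f (diag fun i => g _ (u i)) ∈ O
        rw [← hequi g hg u, h1]
        exact h2
      exact ⟨fun i => ⟨u i, hu i⟩, hstab d _ h1⟩

/-- The subgroups that occur in the sort `m(k, J)` are, among the open normal subgroups of index
at most `k`, the stabilizers of the algebraic tuples in a definable set. -/
theorem IsPair.exists_coding (h : IsPair C κ M K) (k : ℕ) (J : List ι) :
    ∃ (γ : Type) (_ : Finite γ) (s : γ → ι) (W : (∀ c, C.carrier (s c)) → Prop), C.Def W ∧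
      (∀ H : Subgroup (C.absGal K), C.IsOpenNormal K H → H.index ≠ 0 → H.index ≤ k →
        J ∈ C.sorting K H → ∃ a : ∀ c, C.acl K (s c), W (fun c => (a c).1) ∧ stab a = H) ∧
      ∀ a : ∀ c, C.acl K (s c), W (fun c => (a c).1) → (stab a).Normal → (stab a).index ≠ 0 →
        J ∈ C.sorting K (stab a) := by
  classical
  obtain ⟨J', W, hW, h1, ⟨d₀, hd₀, hd₀'⟩, h3⟩ := h.exists_pointed J
  refine ⟨Fin k × Fin J'.length, inferInstance, fun p => J'.get p.2,
    -- one tuple for each of the at most `k` cosets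
    fun a => ∀ n, W fun i => a (n, i), ?_, ?_, ?_⟩
  · exact Def.all_finite fun n => hW.comp (.pi fun i => Reindex.id.eval (n, i))
  · intro H hH hi hk hJ
    obtain ⟨J'', c, rfl⟩ := h.monster.exists_stab_eq h.ei h.small hH.2
    have hs := (h.monster.mem_sorting_iff h.small c hH.1 hi J).1 hJ
    -- for every coset a tuple whose stabilizer contains `H` and avoids the nontrivial coset
    have hq : ∀ q : C.absGal K ⧸ stab c, ∃ d : ∀ i : Fin J'.length, C.acl K (J'.get i),
        W (fun i => (d i).1) ∧ stab c ≤ stab d ∧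
          ∀ τ : C.absGal K, (τ : C.absGal K ⧸ stab c) = q → τ ∈ stab d → τ ∈ stab c := by
      intro q
      obtain ⟨τ, rfl⟩ := QuotientGroup.mk_surjective q
      by_cases hτ : τ ∈ stab c
      · refine ⟨d₀, hd₀, hd₀' ▸ le_top, fun τ' hτ' _ => ?_⟩
        have := QuotientGroup.eq.1 hτ'
        simpa using mul_mem hτ (inv_mem this)
      · have := mt (hs τ) hτ
        push Not at this
        obtain ⟨x, i, hxi⟩ := this
        obtain ⟨d, hd, hdx⟩ := h1 fun i => ⟨(x i).1, (x i).2.1⟩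
        have hle : stab c ≤ stab d := hdx ▸ fun σ hσ i => (x i).2.2 σ hσ
        refine ⟨d, hd, hle, fun τ' hτ' hτd => ?_⟩
        have h4 : τ ∈ stab d := by
          have := mul_mem hτd (hle (QuotientGroup.eq.1 hτ'))
          simpa using this
        rw [hdx] at h4
        exact absurd (congrArg Subtype.val (h4 i)) hxi
    choose d hdW hd1 hd2 using hq
    have : (stab c).FiniteIndex := ⟨hi⟩
    obtain ⟨q, hq⟩ := exists_surjective_of_card_le (X := C.absGal K ⧸ stab c) hk
    refine ⟨fun p => d (q p.1) p.2, fun n => hdW (q n), le_antisymm ?_ ?_⟩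
    · intro τ hτ
      obtain ⟨n, hn⟩ := hq τ
      exact hd2 (q n) τ hn.symm fun i => hτ (n, i)
    · intro τ hτ p
      exact hd1 (q p.1) hτ p.2
  · intro a ha hn hi
    refine (h.monster.mem_sorting_iff h.small a hn hi J).2 fun τ hτ => ?_
    rintro ⟨n, i⟩
    have hle : stab a ≤ stab fun i => a (n, i) := fun σ hσ i => hσ (n, i)
    rcases h3 (fun i => a (n, i)) (ha n) with htop | ⟨x, hx⟩
    · have : τ ∈ stab fun i => a (n, i) := htop ▸ trivial
      exact this i
    · have : τ ∈ stab x := fun i => Subtype.ext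
        (hτ (fun i => ⟨(x i).1, (x i).2, fun σ hσ => (hx ▸ hle) hσ i⟩) i)
      rw [← hx] at this
      exact this i

end Str
end SortedLanguage

namespace SortedLanguage
namespace Str

/-! ### Interpretation of the system in the pair -/

open DSpace in
/-- An interpretation of a relational structure given by coding its elements by points of
finite products of sorts: `Codes j x q` says that `x` codes `q`. -/
theorem interpretableIn_of_codes {ι ι' : Type u} {L : SortedLanguage ι} {L' : SortedLanguage ι'}
    (N : L'.Str) (P : L.Str) (hL' : ∀ J j, IsEmpty (L'.Fn J j)) (Ω : ι' → Type u)
    [∀ j, P.DSpace (Ω j)] (Codes : ∀ j, Ω j → N.carrier j → Prop)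
    (huniq : ∀ j x q q', Codes j x q → Codes j x q' → q = q') (hsurj : ∀ j q, ∃ x, Codes j x q)
    (heq : ∀ j, P.Def fun p : Ω j × Ω j => ∃ q, Codes j p.1 q ∧ Codes j p.2 q)
    (hrel : ∀ (J : List ι') (R : L'.Rel J), P.Def fun x : ∀ i : Fin J.length, Ω (J.get i) =>
      ∃ q : ∀ i, N.carrier (J.get i), (∀ i, Codes _ (x i) (q i)) ∧ N.rel R q) :
    N.InterpretableIn P := by
  choose l e he using fun j => exists_list_equiv (sort (C := P) (Ω := Ω j))
  have he' : ∀ j a, (l j).get (e j a) = sort (C := P) (Ω := Ω j) a := fun j a =>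
    (congrFun (he j) a).symm
  let dec : ∀ j, P.Tup (l j) → Ω j := fun j x => chart.symm fun a => he' j a ▸ x (e j a)
  have hdec : ∀ j (x : P.Tup (l j)) a, HEq (chart (C := P) (dec j x) a) (x (e j a)) := by
    intro j x a
    rw [show chart (C := P) (dec j x) = fun a => he' j a ▸ x (e j a) from
      Equiv.apply_symm_apply _ _]
    exact eqRec_heq _ _
  have hdecs : ∀ j, Function.Surjective (dec j) := by
    intro j ω
    have he'' : ∀ i, sort (C := P) (Ω := Ω j) ((e j).symm i) = (l j).get i := fun i => by
      rw [← he', Equiv.apply_symm_apply]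
    refine ⟨fun i => he'' i ▸ chart ω ((e j).symm i), (chart (C := P)).injective
      (funext fun a => eq_of_heq (HEq.trans (hdec j (fun i => he'' i ▸ chart ω ((e j).symm i)) a)
        ((eqRec_heq _ _).trans ?_)))⟩
    rw [Equiv.symm_apply_apply]
  choose f hf using fun j (x : {x : P.Tup (l j) | ∃ q, Codes j (dec j x) q}) => x.2
  have hfc : ∀ j x q, Codes j (dec j x.1) q ↔ f j x = q := fun j x q =>
    ⟨fun h => huniq _ _ _ _ (hf j x) h, fun h => h ▸ hf j x⟩
  refine ⟨l, fun j => {x | ∃ q, Codes j (dec j x) q}, f, fun j => ?_, fun j q => ?_, fun j => ?_,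
    fun J R => ?_, fun J j g => ((hL' J j).false g).elim⟩
  · have h1 : P.Def fun ω : Ω j => ∃ q, Codes j ω q :=
      ((heq j).comp (Reindex.id.pair Reindex.id)).congr fun ω => by simp
    exact Definable.of_def h1 (dec j) (e j) (he' j) (hdec j)
  · obtain ⟨ω, hω⟩ := hsurj j q
    obtain ⟨x, rfl⟩ := hdecs j ω
    exact ⟨⟨x, q, hω⟩, (hfc _ _ _).1 hω⟩
  · convert Definable.of_def (t := Sum.elim (l j).get (l j).get) (heq j)
      (fun x => (dec j fun i => x (.inl i), dec j fun i => x (.inr i)))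
      (Sum.map (e j) (e j)) (by rintro (a | a); exacts [he' j a, he' j a])
      (by
        rintro x (a | a)
        exacts [hdec j (fun i => x (.inl i)) a, hdec j (fun i => x (.inr i)) a]) using 1
    ext x
    constructor
    · rintro ⟨h₁, h₂, h⟩
      exact ⟨_, hf j ⟨_, h₁⟩, h ▸ hf j ⟨_, h₂⟩⟩
    · rintro ⟨q, h₁, h₂⟩
      exact ⟨⟨q, h₁⟩, ⟨q, h₂⟩, ((hfc j ⟨_, q, h₁⟩ q).1 h₁).trans ((hfc j ⟨_, q, h₂⟩ q).1 h₂).symm⟩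
  · convert Definable.of_def
      (t := fun p : Σ i : Fin J.length, Fin (l (J.get i)).length => (l (J.get p.1)).get p.2)
      (hrel J R) (fun x i => dec _ fun k => x ⟨i, k⟩)
      (fun p => ⟨p.1, e _ p.2⟩) (fun p => he' _ p.2)
      (fun x p => hdec _ (fun k => x ⟨p.1, k⟩) p.2) using 1
    ext x
    constructor
    · rintro ⟨h, hR⟩
      exact ⟨_, fun i => hf _ ⟨_, h i⟩, hR⟩
    · rintro ⟨q, hq, hR⟩
      refine ⟨fun i => ⟨q i, hq i⟩, ?_⟩
      convert hR using 1
      exact funext fun i => (hfc _ ⟨_, q i, hq i⟩ _).1 (hq i)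

variable {ι : Type u} {L : SortedLanguage ι} {C : L.Str} {κ : Cardinal.{u}} {K : C.SSet}
variable {M : C.Substr} {γ δ ε : Type} {s : γ → ι} {t : δ → ι} {r : ε → ι}

/-- The pair of tuples `(x, x')` codes the coset `gH`, where `H` is the stabilizer of `x` and
`g` moves `x` to `x'`. -/
def CodesCoset {A : ℕ × List ι} (x x' : ∀ c, C.carrier (s c)) (q : C.SGSort K A) : Prop :=
  ∃ a a' : ∀ c, C.acl K (s c), x = (fun c => (a c).1) ∧ x' = (fun c => (a' c).1) ∧
    stab a = q.1.1 ∧ ∃ σ : C.absGal K, (∀ c, σ.1 _ (a c) = a' c) ∧ q.2 = QuotientGroup.mk σ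

namespace CodesCoset

variable {A B D : ℕ × List ι} {x x' : ∀ c, C.carrier (s c)} {y y' : ∀ d, C.carrier (t d)}
  {z z' : ∀ d, C.carrier (r d)} {p : C.SGSort K A} {q : C.SGSort K B} {o : C.SGSort K D}

/-- The data of a code: the subgroup is `stab a`, and its cosets are compared on `a`. -/
theorem exists_acl (h : CodesCoset x x' p) :
    ∃ a a' : ∀ c, C.acl K (s c), x = (fun c => (a c).1) ∧ x' = (fun c => (a' c).1) ∧
      stab a = p.1.1 ∧ ∀ τ : C.absGal K, p.2 = QuotientGroup.mk τ ↔ ∀ c, τ.1 _ (a c) = a' c := by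
  obtain ⟨a, a', hx, hx', ha, σ, hσ, hp⟩ := h
  obtain ⟨⟨H, hH⟩, P⟩ := p
  obtain rfl : stab a = H := ha
  refine ⟨a, a', hx, hx', rfl, fun τ => ?_⟩
  rw [show P = QuotientGroup.mk σ from hp, quotient_mk_eq_iff]
  refine forall_congr' fun c => ?_
  rw [hσ c, eq_comm]

theorem le_iff [Finite γ] [Finite δ] (hC : C.IsMonster κ) (hK : #K.Elem < κ)
    (hp : CodesCoset x x' p) (hq : CodesCoset y y' q) : SGLe p q ↔ StabLE K x y := by
  obtain ⟨a, a', rfl, rfl, ha, -⟩ := hp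
  obtain ⟨b, b', rfl, rfl, hb, -⟩ := hq
  rw [hC.stabLE_iff hK, ha, hb]
  rfl

theorem proj_iff [Finite γ] [Finite δ] (hC : C.IsMonster κ) (hK : #K.Elem < κ)
    (hp : CodesCoset x x' p) (hq : CodesCoset y y' q) : SGProj p q ↔ StabLE K x y ∧
      ∃ g ∈ C.autFix K, (∀ c, g _ (x c) = x' c) ∧ ∀ d, g _ (y d) = y' d := by
  refine and_congr (le_iff hC hK hp hq) ?_
  obtain ⟨a, a', rfl, rfl, ha, ha'⟩ := hp.exists_acl
  obtain ⟨b, b', rfl, rfl, hb, hb'⟩ := hq.exists_acl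
  rw [hC.conjOver_pair_iff hK]
  exact exists_congr fun σ => and_congr (ha' σ) (hb' σ)

theorem eq_iff [Finite γ] [Finite δ] (hC : C.IsMonster κ) (hK : #K.Elem < κ) {q : C.SGSort K A}
    (hp : CodesCoset x x' p) (hq : CodesCoset y y' q) :
    p = q ↔ StabLE K x y ∧ StabLE K y x ∧
      ∃ g ∈ C.autFix K, (∀ c, g _ (x c) = x' c) ∧ ∀ d, g _ (y d) = y' d := by
  obtain ⟨a, a', rfl, rfl, ha, ha'⟩ := hp.exists_acl
  obtain ⟨b, b', rfl, rfl, hb, hb'⟩ := hq.exists_acl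
  rw [hC.conjOver_pair_iff hK, hC.stabLE_iff hK, hC.stabLE_iff hK, ha, hb]
  constructor
  · rintro rfl
    obtain ⟨σ, hσ⟩ := QuotientGroup.mk_surjective p.2
    exact ⟨le_rfl, le_rfl, σ, (ha' σ).1 hσ.symm, (hb' σ).1 hσ.symm⟩
  · rintro ⟨h1, h2, σ, hσ, hσ'⟩
    have h3 : p.1 = q.1 := Subtype.ext (le_antisymm h1 h2)
    have h4 := (ha' σ).2 hσ
    have h5 := (hb' σ).2 hσ'
    obtain ⟨H, P⟩ := p
    obtain ⟨H', Q⟩ := q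
    obtain rfl : H = H' := h3
    exact congrArg (Sigma.mk H) (h4.trans h5.symm)

/-- Multiplication of cosets: `g₁g₂` moves `z` to `z'` if `g₂` moves `z` to some `w` that is moved
to `z'` by `g₁`. -/
theorem prod_iff [Finite γ] [Finite δ] [Finite ε] (h : IsPair C κ M K)
    {q o : C.SGSort K A} (hp : CodesCoset x x' p) (hq : CodesCoset y y' q)
    (ho : CodesCoset z z' o) :
    SGProd p q o ↔ StabLE K x y ∧ StabLE K y x ∧ StabLE K x z ∧ StabLE K z x ∧
      ∃ w : ∀ d, (M.pair K).carrier (r d),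
        (∃ g ∈ C.autFix K, (∀ d, g _ (y d) = y' d) ∧ ∀ d, g _ (z d) = M.tup K w d) ∧
        ∃ g ∈ C.autFix K, (∀ c, g _ (x c) = x' c) ∧ ∀ d, g _ (M.tup K w d) = z' d := by
  have hC := h.monster
  have hK := h.small
  obtain ⟨a, a', rfl, rfl, ha, ha'⟩ := hp.exists_acl
  obtain ⟨b, b', rfl, rfl, hb, hb'⟩ := hq.exists_acl
  obtain ⟨d, d', rfl, rfl, hd, hd'⟩ := ho.exists_acl
  rw [hC.stabLE_iff hK, hC.stabLE_iff hK, hC.stabLE_iff hK, hC.stabLE_iff hK, ha, hb, hd]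
  constructor
  · rintro ⟨h1, h2, σ, τ, hσ, hτ, hστ⟩
    obtain ⟨w, hw⟩ := h.exists_tup fun i => (τ.1 _ (d i)).2
    refine ⟨by rw [h1], by rw [h1], by rw [h2], by rw [h2], w, ?_, ?_⟩
    · rw [hw]
      exact (hC.conjOver_pair_iff hK b b' d fun i => τ.1 _ (d i)).2
        ⟨τ, (hb' τ).1 hτ, fun _ => rfl⟩
    · rw [hw]
      exact (hC.conjOver_pair_iff hK a a' (fun i => τ.1 _ (d i)) d').2
        ⟨σ, (ha' σ).1 hσ, (hd' (σ * τ)).1 hστ⟩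
  · rintro ⟨h1, h2, h3, h4, w, ⟨g, hg, hgb, hgd⟩, hw2⟩
    have hw : M.tup K w = fun i => g _ (d i).1 := (funext hgd).symm
    obtain ⟨τ, hτ⟩ := exists_absGal_of_autFix hg
    have hw' : M.tup K w = fun i => (τ.1 _ (d i)).1 := hw.trans (funext fun i => (hτ _ _).symm)
    rw [hw'] at hw2
    obtain ⟨σ, hσa, hσd⟩ := (hC.conjOver_pair_iff hK a a' (fun i => τ.1 _ (d i)) d').1 hw2
    exact ⟨Subtype.ext (le_antisymm h1 h2), Subtype.ext (le_antisymm h3 h4), σ, τ, (ha' σ).2 hσa,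
      (hb' τ).2 fun i => Subtype.ext ((hτ _ _).trans (hgb i)), (hd' (σ * τ)).2 hσd⟩

theorem orbitLE [Finite γ] (hC : C.IsMonster κ) (hK : #K.Elem < κ) (hp : CodesCoset x x' p) :
    OrbitLE K A.1 x := by
  obtain ⟨a, a', rfl, rfl, ha, -⟩ := hp
  rw [hC.orbitLE_iff hK, ha]
  exact ⟨p.1.2.2.1, p.1.2.2.2.1⟩

end CodesCoset

/-- The codes of elements of the sort `A` of the system, for a suitable definable set `W`. -/
theorem IsPair.exists_codesCoset_iff (h : IsPair C κ M K) [Finite γ] {A : ℕ × List ι}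
    {W : (∀ c, C.carrier (s c)) → Prop}
    (hW : ∀ a : ∀ c, C.acl K (s c), W (fun c => (a c).1) → (stab a).Normal →
      (stab a).index ≠ 0 → A.2 ∈ C.sorting K (stab a)) (x x' : ∀ c, C.carrier (s c)) :
    (∃ q : C.SGSort K A, W x ∧ CodesCoset x x' q) ↔ W x ∧
      (OrbitLE K A.1 x ∧ ∀ g ∈ C.autFix K, StabLE K x fun c => g _ (x c)) ∧
      OrbitLE K A.1 x ∧ ConjOver K x x' := by
  have hC := h.monster
  have hK := h.small
  constructor
  · rintro ⟨q, hx, hq⟩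
    have ho := hq.orbitLE hC hK
    obtain ⟨a, a', rfl, rfl, ha, σ, hσ, -⟩ := hq
    refine ⟨hx, ⟨ho, fun g hg => ?_⟩, ho, (hC.conjOver_iff hK a a').2 ⟨σ, hσ⟩⟩
    obtain ⟨τ, hτ⟩ := exists_absGal_of_autFix hg
    simp only [← hτ]
    refine (hC.stabLE_iff hK a fun c => τ.1 _ (a c)).2 fun ρ hρ c => ?_
    have hn : (stab a).Normal := ha ▸ q.1.2.1.1
    have h1 : τ⁻¹ * ρ * τ ∈ stab a := by simpa using hn.conj_mem ρ hρ τ⁻¹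
    exact (Equiv.symm_apply_eq (τ.1 (s c))).1 (h1 c)
  · rintro ⟨hx, ⟨ho, hn⟩, -, hc⟩
    have hxacl : ∀ c, x c ∈ C.acl K (s c) := hC.mem_acl_of_orbitLE hK ho
    have hx'acl : ∀ c, x' c ∈ C.acl K (s c) := hC.mem_acl_of_orbitLE hK (hc.orbitLE ho)
    obtain ⟨a, rfl⟩ : ∃ a : ∀ c, C.acl K (s c), x = fun c => (a c).1 :=
      ⟨fun c => ⟨x c, hxacl c⟩, rfl⟩
    obtain ⟨a', rfl⟩ : ∃ a : ∀ c, C.acl K (s c), x' = fun c => (a c).1 :=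
      ⟨fun c => ⟨x' c, hx'acl c⟩, rfl⟩
    obtain ⟨σ, hσ⟩ := (hC.conjOver_iff hK a a').1 hc
    have hi := (hC.orbitLE_iff hK a A.1).1 ho
    have hnor : (stab a).Normal := by
      refine ⟨fun ρ hρ τ c => ?_⟩
      obtain ⟨g, hg, hga⟩ := hC.exists_autFix hK τ⁻¹ a
      have h1 := hn g hg
      simp only [hga] at h1
      have h2 := (hC.stabLE_iff hK a fun c => τ⁻¹.1 _ (a c)).1 h1 hρ c
      have h3 : τ.1 (s c) (ρ.1 _ (τ⁻¹.1 _ (a c))) = τ.1 _ (τ⁻¹.1 _ (a c)) :=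
        congrArg (τ.1 (s c)) h2
      exact h3.trans ((τ.1 (s c)).apply_symm_apply (a c))
    exact ⟨⟨⟨stab a, ⟨hnor, isOpen_stab a⟩, hi.1, hi.2, hW a hx hnor hi.1⟩, QuotientGroup.mk σ⟩,
      hx, a, a', rfl, rfl, rfl, σ, hσ, rfl⟩

theorem IsPair.interpretableIn (h : IsPair C κ M K) : (C.SG K).InterpretableIn (M.pair K) := by
  have hC := h.monster
  have hK := h.small
  choose γ hfin s W hW h1 h2 using fun A : ℕ × List ι => h.exists_coding A.1 A.2
  let T : ℕ × List ι → Type u := fun A => ∀ c, (M.pair K).carrier (s A c)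
  let Codes : ∀ A, T A × T A → C.SGSort K A → Prop := fun A x q =>
    W A (M.tup K x.1) ∧ CodesCoset (M.tup K x.1) (M.tup K x.2) q
  have hgood : ∀ A, (M.pair K).Def fun x : T A × T A => ∃ q, Codes A x q := fun A =>
    (((h.def_tup (hW A)).comp Reindex.fst).and (((h.def_normal (s A) A.1).comp Reindex.fst).and
      (h.def_conjOver (s A) A.1))).congr fun x => h.exists_codesCoset_iff (h2 A) _ _
  have hbd : ∀ A x q, Codes A x q → OrbitLE K A.1 (M.tup K x.1) := fun A x q hq =>
    hq.2.orbitLE hC hK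
  have hst := fun A B => h.def_stabLE (s A) (s B) A.1 B.1
  have hcp := fun A B => h.def_conjOver_pair (s A) (s B) A.1 B.1
  -- all relations are definable on the pairs of points that are codes
  have hle : ∀ A B, (M.pair K).Def fun p : (T A × T A) × (T B × T B) =>
      ∃ q q', Codes A p.1 q ∧ Codes B p.2 q' ∧ SGLe q q' := by
    intro A B
    refine (((hgood A).comp Reindex.fst).and (((hgood B).comp Reindex.snd).and
      ((hst A B).comp (Reindex.fst.fst'.pair Reindex.snd.fst')))).congr fun p => ?_
    constructor
    · rintro ⟨q, q', hq, hq', hqq⟩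
      exact ⟨⟨q, hq⟩, ⟨q', hq'⟩, hbd _ _ _ hq, hbd _ _ _ hq', (hq.2.le_iff hC hK hq'.2).1 hqq⟩
    · rintro ⟨⟨q, hq⟩, ⟨q', hq'⟩, -, -, hqq⟩
      exact ⟨q, q', hq, hq', (hq.2.le_iff hC hK hq'.2).2 hqq⟩
  have hproj : ∀ A B, (M.pair K).Def fun p : (T A × T A) × (T B × T B) =>
      ∃ q q', Codes A p.1 q ∧ Codes B p.2 q' ∧ SGProj q q' := by
    intro A B
    refine (((hgood A).comp Reindex.fst).and (((hgood B).comp Reindex.snd).and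
      (((hst A B).comp (Reindex.fst.fst'.pair Reindex.snd.fst')).and
      ((hcp A B).comp ((Reindex.fst.fst'.pair Reindex.snd.fst').pair
        (Reindex.fst.snd'.pair Reindex.snd.snd')))))).congr fun p => ?_
    constructor
    · rintro ⟨q, q', hq, hq', hqq⟩
      have hb := hbd _ _ _ hq
      have hb' := hbd _ _ _ hq'
      have := (hq.2.proj_iff hC hK hq'.2).1 hqq
      exact ⟨⟨q, hq⟩, ⟨q', hq'⟩, ⟨hb, hb', this.1⟩, hb, hb', this.2⟩
    · rintro ⟨⟨q, hq⟩, ⟨q', hq'⟩, ⟨-, -, hqq⟩, -, -, hqq'⟩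
      exact ⟨q, q', hq, hq', (hq.2.proj_iff hC hK hq'.2).2 ⟨hqq, hqq'⟩⟩
  have heq : ∀ A, (M.pair K).Def fun p : (T A × T A) × (T A × T A) =>
      ∃ q, Codes A p.1 q ∧ Codes A p.2 q := by
    intro A
    refine (((hgood A).comp Reindex.fst).and (((hgood A).comp Reindex.snd).and
      (((hst A A).comp (Reindex.fst.fst'.pair Reindex.snd.fst')).and
      (((hst A A).comp (Reindex.snd.fst'.pair Reindex.fst.fst')).and
      ((hcp A A).comp ((Reindex.fst.fst'.pair Reindex.snd.fst').pair
        (Reindex.fst.snd'.pair Reindex.snd.snd'))))))).congr fun p => ?_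
    constructor
    · rintro ⟨q, hq, hq'⟩
      have hb := hbd _ _ _ hq
      have hb' := hbd _ _ _ hq'
      have := (hq.2.eq_iff hC hK hq'.2).1 rfl
      exact ⟨⟨q, hq⟩, ⟨q, hq'⟩, ⟨hb, hb', this.1⟩, ⟨hb', hb, this.2.1⟩, hb, hb', this.2.2⟩
    · rintro ⟨⟨q, hq⟩, ⟨q', hq'⟩, ⟨-, -, h1⟩, ⟨-, -, h2⟩, -, -, h3⟩
      have := (hq.2.eq_iff hC hK hq'.2).2 ⟨h1, h2, h3⟩
      exact ⟨q, hq, this ▸ hq'⟩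
  have hprod : ∀ A, (M.pair K).Def fun p : (T A × T A) × (T A × T A) × (T A × T A) =>
      ∃ q₁ q₂ q₃, Codes A p.1 q₁ ∧ Codes A p.2.1 q₂ ∧ Codes A p.2.2 q₃ ∧ SGProd q₁ q₂ q₃ := by
    intro A
    let Cj : T A × T A → T A × T A → Prop := fun a b =>
      OrbitLE K A.1 (M.tup K a.1) ∧ OrbitLE K A.1 (M.tup K a.2) ∧
        ∃ g ∈ C.autFix K, (∀ d, g _ (M.tup K a.1 d) = M.tup K b.1 d) ∧
          ∀ d, g _ (M.tup K a.2 d) = M.tup K b.2 d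
    let R : (T A × T A) × (T A × T A) × (T A × T A) → T A → Prop := fun p w =>
      Cj (p.2.1.1, p.2.2.1) (p.2.1.2, w) ∧ Cj (p.1.1, w) (p.1.2, p.2.2.2)
    have hw : (M.pair K).Def fun p : ((T A × T A) × (T A × T A) × (T A × T A)) × T A =>
        R p.1 p.2 :=
      ((hcp A A).comp ((Reindex.fst.snd'.fst'.fst'.pair Reindex.fst.snd'.snd'.fst').pair
        (Reindex.fst.snd'.fst'.snd'.pair Reindex.snd))).and
      ((hcp A A).comp ((Reindex.fst.fst'.fst'.pair Reindex.snd).pair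
        (Reindex.fst.fst'.snd'.pair Reindex.fst.snd'.snd'.snd')))
    refine (((hgood A).comp Reindex.fst).and (((hgood A).comp Reindex.snd.fst').and
      (((hgood A).comp Reindex.snd.snd').and
      (((hst A A).comp (Reindex.fst.fst'.pair Reindex.snd.fst'.fst')).and
      (((hst A A).comp (Reindex.snd.fst'.fst'.pair Reindex.fst.fst')).and
      (((hst A A).comp (Reindex.fst.fst'.pair Reindex.snd.snd'.fst')).and
      (((hst A A).comp (Reindex.snd.snd'.fst'.pair Reindex.fst.fst')).and
      (Def.ex (P := R) hw)))))))).congr fun p => ?_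
    constructor
    · rintro ⟨q₁, q₂, q₃, hq₁, hq₂, hq₃, hqq⟩
      have hb₁ := hbd _ _ _ hq₁
      have hb₂ := hbd _ _ _ hq₂
      have hb₃ := hbd _ _ _ hq₃
      obtain ⟨e1, e2, e3, e4, w, hw1, hw2⟩ := (hq₁.2.prod_iff h hq₂.2 hq₃.2).1 hqq
      have hbw : OrbitLE K A.1 (M.tup K w) := by
        obtain ⟨g, hg, -, hgw⟩ := hw1
        exact ConjOver.orbitLE ⟨g, hg, hgw⟩ hb₃
      exact ⟨⟨q₁, hq₁⟩, ⟨q₂, hq₂⟩, ⟨q₃, hq₃⟩, ⟨hb₁, hb₂, e1⟩, ⟨hb₂, hb₁, e2⟩, ⟨hb₁, hb₃, e3⟩,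
        ⟨hb₃, hb₁, e4⟩, w, ⟨hb₂, hb₃, hw1⟩, hb₁, hbw, hw2⟩
    · rintro ⟨⟨q₁, hq₁⟩, ⟨q₂, hq₂⟩, ⟨q₃, hq₃⟩, ⟨-, -, e1⟩, ⟨-, -, e2⟩, ⟨-, -, e3⟩, ⟨-, -, e4⟩,
        w, ⟨-, -, hw1⟩, -, -, hw2⟩
      exact ⟨q₁, q₂, q₃, hq₁, hq₂, hq₃,
        (hq₁.2.prod_iff h hq₂.2 hq₃.2).2 ⟨e1, e2, e3, e4, w, hw1, hw2⟩⟩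
  refine interpretableIn_of_codes (C.SG K) (M.pair K) (fun _ _ => inferInstanceAs (IsEmpty PEmpty))
    (fun A => T A × T A) Codes ?_ ?_ heq ?_
  · intro A x q q' hq hq'
    refine (hq.2.eq_iff hC hK hq'.2).2 ?_
    obtain ⟨a, a', ha, ha', -, σ, hσ, -⟩ := hq.2
    obtain ⟨g, hg, hga⟩ := (hC.conjOver_iff hK a a').2 ⟨σ, hσ⟩
    refine ⟨fun _ _ h => h, fun _ _ h => h, g, hg, ?_⟩
    rw [ha, ha']
    exact ⟨hga, hga⟩
  · intro A q
    obtain ⟨H, Q⟩ := q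
    obtain ⟨a, haW, ha⟩ := h1 A H.1 H.2.1 H.2.2.1 H.2.2.2.1 H.2.2.2.2
    obtain ⟨σ, rfl⟩ := QuotientGroup.mk_surjective Q
    obtain ⟨x, hx⟩ := h.exists_tup fun c => (a c).2
    obtain ⟨x', hx'⟩ := h.exists_tup fun c => (σ.1 _ (a c)).2
    exact ⟨(x, x'), by rw [hx]; exact haW, a, _, hx, hx', ha, σ, fun _ => rfl, rfl⟩
  · rintro J (⟨A, B⟩ | ⟨A, B⟩ | ⟨A⟩)
    · refine ((hle A B).comp (f := fun x : ∀ i : Fin [A, B].length,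
        T ([A, B].get i) × T ([A, B].get i) => (x ⟨0, by simp⟩, x ⟨1, by simp⟩))
        ((Reindex.id.eval _).pair (Reindex.id.eval _))).congr fun x => ?_
      constructor
      · rintro ⟨q, hq, h⟩
        exact ⟨q ⟨0, by simp⟩, q ⟨1, by simp⟩, hq ⟨0, by simp⟩, hq ⟨1, by simp⟩, h⟩
      · rintro ⟨q, q', hq, hq', h⟩
        let o : ∀ i : Fin [A, B].length, C.SGSort K ([A, B].get i) :=
          Fin.cases q (Fin.cases q' fun i => i.elim0)
        exact ⟨o, Fin.cases hq (Fin.cases hq' fun i => i.elim0), h⟩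
    · refine ((hproj A B).comp (f := fun x : ∀ i : Fin [A, B].length,
        T ([A, B].get i) × T ([A, B].get i) => (x ⟨0, by simp⟩, x ⟨1, by simp⟩))
        ((Reindex.id.eval _).pair (Reindex.id.eval _))).congr fun x => ?_
      constructor
      · rintro ⟨q, hq, h⟩
        exact ⟨q ⟨0, by simp⟩, q ⟨1, by simp⟩, hq ⟨0, by simp⟩, hq ⟨1, by simp⟩, h⟩
      · rintro ⟨q, q', hq, hq', h⟩
        let o : ∀ i : Fin [A, B].length, C.SGSort K ([A, B].get i) :=
          Fin.cases q (Fin.cases q' fun i => i.elim0)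
        exact ⟨o, Fin.cases hq (Fin.cases hq' fun i => i.elim0), h⟩
    · refine ((hprod A).comp (f := fun x : ∀ i : Fin [A, A, A].length,
        T ([A, A, A].get i) × T ([A, A, A].get i) =>
          (x ⟨0, by simp⟩, x ⟨1, by simp⟩, x ⟨2, by simp⟩))
        ((Reindex.id.eval _).pair ((Reindex.id.eval _).pair (Reindex.id.eval _)))).congr
        fun x => ?_
      constructor
      · rintro ⟨q, hq, h⟩
        exact ⟨q ⟨0, by simp⟩, q ⟨1, by simp⟩, q ⟨2, by simp⟩, hq ⟨0, by simp⟩, hq ⟨1, by simp⟩,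
          hq ⟨2, by simp⟩, h⟩
      · rintro ⟨q₁, q₂, q₃, hq₁, hq₂, hq₃, h⟩
        let o : ∀ i : Fin [A, A, A].length, C.SGSort K ([A, A, A].get i) :=
          Fin.cases q₁ (Fin.cases q₂ (Fin.cases q₃ fun i => i.elim0))
        exact ⟨o, Fin.cases hq₁ (Fin.cases hq₂ (Fin.cases hq₃ fun i => i.elim0)), h⟩

end Str
end SortedLanguage

namespace SortedLanguage
namespace Str

/-! ### Interpretations preserve saturation -/

section Translation

variable {ι ι' : Type u} {L : SortedLanguage ι} {L' : SortedLanguage ι'} {N : L'.Str} {P : L.Str}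

/-- The sorts of the variables that replace the variables `α` of sorts `s`, where a variable of
sort `j` is replaced by a block of variables of sorts `J j`. -/
abbrev blockSort (J : ι' → List ι) {α : Type v} (s : α → ι') :
    (Σ a, Fin (J (s a)).length) → ι :=
  fun p => (J (s p.1)).get p.2

/-- The block of variables that replaces the variable `a`. -/
def blockVar (J : ι' → List ι) {α : Type v} {s : α → ι'} {a : α} {j : ι'} (h : s a = j)
    (k : Fin (J j).length) : Σ a, Fin (J (s a)).length :=
  ⟨a, Fin.cast (by rw [h]) k⟩

theorem blockSort_blockVar (J : ι' → List ι) {α : Type v} {s : α → ι'} {a : α} {j : ι'}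
    (h : s a = j) (k : Fin (J j).length) : blockSort J s (blockVar J h k) = (J j).get k := by
  subst h
  rfl

theorem apply_blockVar {J : ι' → List ι} {D : ∀ j, Set (P.Tup (J j))}
    (f : ∀ j, D j → N.carrier j) {α : Type v} {s : α → ι'}
    (x : ∀ p, P.carrier (blockSort J s p)) {a : α} (hx : (fun k => x ⟨a, k⟩) ∈ D (s a)) {j : ι'}
    (h : s a = j) : ∃ hy : (fun k => (blockSort_blockVar J h k ▸ x (blockVar J h k) :
      P.carrier ((J j).get k))) ∈ D j, f j ⟨_, hy⟩ = h ▸ f (s a) ⟨_, hx⟩ := by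
  subst h
  exact ⟨hx, rfl⟩

theorem exists_var_of_term (hL' : ∀ J j, IsEmpty (L'.Fn J j)) {α : Type v} {s : α → ι'}
    {j : ι'} (t : L'.Term s j) :
    ∃ (a : α) (h : s a = j), ∀ x : ∀ a, N.carrier (s a), N.val x t = h ▸ x a := by
  cases t with
  | var a => exact ⟨a, rfl, fun _ => rfl⟩
  | app f _ => exact ((hL' _ _).false f).elim

/-- Translation of formulas along an interpretation of a relational structure. -/
theorem exists_translation (hL' : ∀ J j, IsEmpty (L'.Fn J j)) {J : ι' → List ι}
    {D : ∀ j, Set (P.Tup (J j))} {f : ∀ j, D j → N.carrier j}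
    (hD : ∀ j, P.Definable (J j).get (D j)) (hf : ∀ j, Function.Surjective (f j))
    (heq : ∀ j, P.Definable (Sum.elim (J j).get (J j).get)
      {x | ∃ (h₁ : (fun i => x (Sum.inl i)) ∈ D j) (h₂ : (fun i => x (Sum.inr i)) ∈ D j),
        f j ⟨_, h₁⟩ = f j ⟨_, h₂⟩})
    (hrel : ∀ (J' : List ι') (R : L'.Rel J'),
      P.Definable
        (fun p : Σ i : Fin J'.length, Fin (J (J'.get i)).length => (J (J'.get p.1)).get p.2)
        {x | ∃ h : ∀ i : Fin J'.length, (fun k => x ⟨i, k⟩) ∈ D (J'.get i),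
          N.rel R (fun i => f (J'.get i) ⟨_, h i⟩)})
    {α : Type v} {s : α → ι'} (φ : L'.Formula s) :
    ∃ ψ : L.Formula (blockSort J s), ∀ (x : ∀ p, P.carrier (blockSort J s p))
      (h : ∀ a, (fun k => x ⟨a, k⟩) ∈ D (s a)),
      P.Sat ψ x ↔ N.Sat φ (fun a => f _ ⟨_, h a⟩) := by
  induction φ with
  | falsum => exact ⟨.falsum, fun _ _ => Iff.rfl⟩
  | @eq α s j t₁ t₂ =>
    obtain ⟨a, ha, hta⟩ := exists_var_of_term (N := N) hL' t₁
    obtain ⟨b, hb, htb⟩ := exists_var_of_term (N := N) hL' t₂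
    obtain ⟨ψ, hψ⟩ := (heq j).relabel (t := blockSort J s)
      (Sum.elim (blockVar J ha) (blockVar J hb))
      (by rintro (k | k); exacts [blockSort_blockVar J ha k, blockSort_blockVar J hb k])
    refine ⟨ψ, fun x h => (hψ x).symm.trans ?_⟩
    obtain ⟨ha', hfa⟩ := apply_blockVar f x (h a) ha
    obtain ⟨hb', hfb⟩ := apply_blockVar f x (h b) hb
    rw [Sat, hta, htb, ← hfa, ← hfb]
    exact ⟨fun ⟨_, _, h⟩ => h, fun h => ⟨ha', hb', h⟩⟩
  | @rel α s J' R t =>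
    choose a ha hta using fun i => exists_var_of_term (N := N) hL' (t i)
    obtain ⟨ψ, hψ⟩ := (hrel J' R).relabel (t := blockSort J s)
      (fun p => blockVar J (ha p.1) p.2) (fun p => blockSort_blockVar J (ha p.1) p.2)
    refine ⟨ψ, fun x h => (hψ x).symm.trans ?_⟩
    choose ha' hfa using fun i => apply_blockVar f x (h (a i)) (ha i)
    have : (fun i => N.val (fun a => f _ ⟨_, h a⟩) (t i)) = fun i => f _ ⟨_, ha' i⟩ :=
      funext fun i => (hta i _).trans (hfa i).symm
    rw [Sat, this]
    exact ⟨fun ⟨_, h⟩ => h, fun h => ⟨ha', h⟩⟩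
  | imp φ χ ih₁ ih₂ =>
    obtain ⟨ψ₁, h₁⟩ := ih₁
    obtain ⟨ψ₂, h₂⟩ := ih₂
    exact ⟨.imp ψ₁ ψ₂, fun x h => imp_congr (h₁ x h) (h₂ x h)⟩
  | @all α s j φ ih =>
    obtain ⟨ψ, hψ⟩ := ih
    let e : (Σ o, Fin (J (extend s j o)).length) →
        (Σ a, Fin (J (s a)).length) ⊕ Fin (J j).length := fun p => match p with
      | ⟨none, k⟩ => .inr k
      | ⟨some a, k⟩ => .inl ⟨a, k⟩
    have he : ∀ p, Sum.elim (blockSort J s) (J j).get (e p) = blockSort J (extend s j) p := by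
      rintro ⟨_ | a, k⟩ <;> rfl
    have h1 : P.Definable (Sum.elim (blockSort J s) (J j).get)
        {z | (fun k => z (Sum.inr k)) ∈ D j} :=
      (hD j).relabel (t := Sum.elim (blockSort J s) (J j).get) Sum.inr fun _ => rfl
    have h2 : P.Definable (blockSort J (extend s j)) {z | P.Sat ψ z} := ⟨ψ, fun _ => Iff.rfl⟩
    obtain ⟨χ, hχ⟩ := (h1.imp (h2.relabel e he)).all_finite
    refine ⟨χ, fun x h => (hχ x).symm.trans ?_⟩
    have key : ∀ (d : P.Tup (J j)) (hd : d ∈ D j),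
        P.Sat ψ (fun p => (he p ▸ sumVal (t := (J j).get) x d (e p) :
          P.carrier (blockSort J (extend s j) p))) ↔
        N.Sat φ (N.extendVal (fun a => f _ ⟨_, h a⟩) (f j ⟨d, hd⟩)) := by
      intro d hd
      refine (hψ _ fun o => ?_).trans (Eq.to_iff (congrArg (N.Sat φ) (funext fun o => ?_)))
      · rcases o with _ | a
        exacts [hd, h a]
      · rcases o with _ | a <;> rfl
    constructor
    · intro hx y
      obtain ⟨⟨d, hd⟩, rfl⟩ := hf j y
      exact (key d hd).1 (hx d hd)
    · intro hx d hd
      exact (key d hd).2 (hx (f j ⟨d, hd⟩))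

theorem mk_sigma_fin_lt {X : Type u} {μ : Cardinal.{u}} (hμ : ℵ₀ ≤ μ) (hX : #X < μ)
    (n : X → ℕ) : #(Σ x, Fin (n x)) < μ := by
  rcases finite_or_infinite X with hfin | hinf
  · exact (lt_aleph0_of_finite _).trans_le hμ
  · refine lt_of_le_of_lt ?_ hX
    have h1 : Function.Injective fun p : Σ x, Fin (n x) => ((p.1, p.2.1) : X × ℕ) := by
      rintro ⟨x, i⟩ ⟨y, k⟩ h
      obtain ⟨rfl, h⟩ := Prod.ext_iff.1 h
      exact congrArg (Sigma.mk x) (Fin.ext h)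
    refine (mk_le_of_injective h1).trans ?_
    rw [mk_prod, mk_nat, lift_uzero, lift_aleph0, mul_aleph0_eq (aleph0_le_mk X)]

/-- A relational structure interpretable without parameters in a `μ`-saturated structure is
`μ`-saturated. -/
theorem Saturated.of_interpretableIn (hL' : ∀ J j, IsEmpty (L'.Fn J j))
    (hN : N.InterpretableIn P) {μ : Cardinal.{u}} (hμ : ℵ₀ ≤ μ) (hP : P.Saturated μ) :
    N.Saturated μ := by
  obtain ⟨J, D, f, hD, hf, heq, hrel, -⟩ := hN
  intro A hA β _ s p hp
  -- representatives of the parameters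
  choose d hd using fun c : A.Elem => hf c.1 c.2.1
  let A' : P.SSet := fun i => {y | ∃ p : Σ c : A.Elem, Fin (J c.1).length,
    (⟨(J p.1.1).get p.2, (d p.1).1 p.2⟩ : Σ i, P.carrier i) = ⟨i, y⟩}
  have hA' : #A'.Elem < μ := by
    refine lt_of_le_of_lt ?_ (mk_sigma_fin_lt hμ hA fun c => (J c.1).length)
    refine mk_le_of_surjective (f := fun p => (⟨(J p.1.1).get p.2, (d p.1).1 p.2, p, rfl⟩ :
      A'.Elem)) ?_
    rintro ⟨i, y, p, hpy⟩
    obtain ⟨rfl, h⟩ := Sigma.mk.inj_iff.1 hpy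
    obtain rfl := eq_of_heq h
    exact ⟨p, rfl⟩
  choose tr htr using fun φ : L'.Formula (withParams s A) =>
    exists_translation hL' hD hf heq hrel φ
  let e : (Σ c, Fin (J (withParams s A c)).length) →
      (Σ b, Fin (J (s b)).length) ⊕ A'.Elem := fun p => match p with
    | ⟨.inl b, k⟩ => .inl ⟨b, k⟩
    | ⟨.inr c, k⟩ => .inr ⟨(J c.1).get k, (d c).1 k, ⟨c, k⟩, rfl⟩
  have he : ∀ p, withParams (blockSort J s) A' (e p) = blockSort J (withParams s A) p := by
    rintro ⟨b | c, k⟩ <;> rfl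
  let T : L'.Formula (withParams s A) → L.Formula (withParams (blockSort J s) A') :=
    fun φ => (tr φ).relabel e he
  have hT : ∀ φ (x : ∀ p, P.carrier (blockSort J s p))
      (hx : ∀ b, (fun k => x ⟨b, k⟩) ∈ D (s b)), P.Sat (T φ) (withParamsVal A' x) ↔
        N.Sat φ (withParamsVal A fun b => f _ ⟨_, hx b⟩) := by
    intro φ x hx
    refine (P.sat_relabel (tr φ) e he _).trans ((htr φ _ fun c => ?_).trans
      (Eq.to_iff (congrArg (N.Sat φ) (funext fun c => ?_))))
    · rcases c with b | c
      exacts [hx b, (d c).2]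
    · rcases c with b | c
      exacts [rfl, hd c]
  have hDb : ∀ b : β, ∃ ψ : L.Formula (withParams (blockSort J s) A'),
      ∀ x, (fun k => x (.inl ⟨b, k⟩)) ∈ D (s b) ↔ P.Sat ψ x := fun b =>
    (hD (s b)).relabel (t := withParams (blockSort J s) A') (fun k => .inl ⟨b, k⟩) fun _ => rfl
  choose Δ hΔ using hDb
  obtain ⟨x, hx⟩ := hP A' hA' (Σ b, Fin (J (s b)).length) (blockSort J s)
    (T '' p ∪ Set.range Δ) (by
      intro q hq hfin
      obtain ⟨q₀, hq₀, hq₀fin, hq₀q⟩ := Set.exists_subset_image_finite_and.1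
        ⟨q ∩ T '' p, Set.inter_subset_right, hfin.subset Set.inter_subset_left,
          (rfl : q ∩ T '' p = q ∩ T '' p)⟩
      obtain ⟨y, hy⟩ := hp q₀ hq₀ hq₀fin
      choose x hx using fun b => hf (s b) (y b)
      refine ⟨fun p => (x p.1).1 p.2, fun ψ hψ => ?_⟩
      rcases hq hψ with hψT | ⟨b, rfl⟩
      · obtain ⟨φ, hφ, rfl⟩ : ψ ∈ T '' q₀ := hq₀q ▸ ⟨hψ, hψT⟩
        refine (hT φ _ fun b => (x b).2).2 ?_
        simp only [hx]
        exact hy φ hφ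
      · exact (hΔ b _).1 (x b).2)
  have hxD : ∀ b, (fun k => x ⟨b, k⟩) ∈ D (s b) := fun b =>
    (hΔ b _).2 (hx _ (Or.inr ⟨b, rfl⟩))
  exact ⟨fun b => f _ ⟨_, hxD b⟩, fun φ hφ => (hT φ x hxD).1 (hx _ (Or.inl ⟨φ, hφ, rfl⟩))⟩

end Translation

end Str
end SortedLanguage

theorem mainTheorem10 {ι : Type u} (L : SortedLanguage ι) (C : L.Str) (κ : Cardinal.{u})
    (hC : C.IsMonster κ) (hEI : C.UniformEI)
    (M : C.Substr) (hM : M.IsElementary)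
    (K : C.SSet) (hsmall : #K.Elem < κ) (hdcl : C.dcl K = K) (hKM : K ≤ M.set) :
    (C.SG K).InterpretableIn (M.pair K) ∧
      ∀ μ : Cardinal.{u}, ℵ₀ ≤ μ → (M.pair K).Saturated μ → (C.SG K).Saturated μ := by
  have h : SortedLanguage.Str.IsPair C κ M K := ⟨hC, hEI, hM, hsmall, hdcl, hKM⟩
  refine ⟨h.interpretableIn, fun μ hμ hsat => ?_⟩
  exact SortedLanguage.Str.Saturated.of_interpretableIn
    (fun _ _ => inferInstanceAs (IsEmpty PEmpty))
    h.interpretableIn hμ hsat
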